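/- **Setting.** Let $\tau\in(0,1)$, $p\ge 0$, let $X_1,\dots,X_n\in\mathbb R$ be a deterministic design, $x_0\in\mathbb R$ a fixed point, $\Psi_i=\bigl((X_i-x_0)^m/m!\bigr)_{m=0}^{p}\in\mathbb R^{p+1}$, and let $W^{(k)}=(w^{(k)}_i)_{i\le n}$, $k=1,\dots,K$, be families of non-negative weights. Under $\mathbb P=\mathbb P_{\theta^*}$ the observations are $Y_i=\Psi_i^\top\theta^*+\varepsilon_i$ with independent $\varepsilon_i$, where $\varepsilon_i$ has the Lebesgue density $\ell_i$ and $\mathbb P(\varepsilon_i<0)=\tau$. With $\rho_\tau(u)=u\{\tau-\mathbf 1(u<0)\}$ put $$L(W^{(k)},\theta)=\log\{\tau(1-\tau)\}\sum_i w^{(k)}_i-\sum_i\rho_\tau(Y_i-\Psi_i^\top\theta)\,w^{(k)}_i ,\qquad L(W^{(k)},\theta,\theta^*)=L(W^{(k)},\theta)-L(W^{(k)},\theta^*),$$ $$\nabla L(W^{(k)},\theta)=\sum_i\{\tau-\mathbf 1(Y_i-\Psi_i^\top\theta<0)\}\Psi_iw^{(k)}_i,\qquad \nabla\zeta_k(\theta)=\nabla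 L(W^{(k)},\theta)-\mathbb E\nabla L(W^{(k)},\theta),$$ $$D_k^2=\sum_i\Psi_i\Psi_i^\top\ell_i(0)w_i^{(k)},\qquad V_k^2=\tau(1-\tau)\sum_i\Psi_i\Psi_i^\top|w_i^{(k)}|^2,$$ $$N_k^{-1/2}=\max_{i\le n}\sup_{\gamma\ne0}\frac{|\gamma^\top\Psi_i|\,\mathbf 1(w^{(k)}_i>0)}{\|V_k\gamma\|}\sqrt{\tau(1-\tau)},\qquad \Theta_k(r)=\{\theta\in\mathbb R^{p+1}:\|V_k(\theta-\theta^*)\|\le r\}.$$ For $\epsilon=(\delta,\varrho)$ let $D_{\epsilon,k}^2=(1-\delta)D_k^2-\varrho V_k^2$ and $$\mathbb L_{\epsilon}(W^{(k)},\theta,\theta^*)=(\theta-\theta^*)^\top\nabla L(W^{(k)},\theta^*)-\tfrac12(\theta-\theta^*)^\top D_{\epsilon,k}^2(\theta-\theta^*);$$ write $\mathbb L_+$ for $\epsilon=(\delta,\varrho)$ and $\mathbb L_-$ for $-\epsilon=(-\delta,-\varrho)$. **Conditions.** Fix $r_0>0$, $\nu_0\ge1$, $g_1>0$ and, for each $k\le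 K$, a number $g_k>0$ with $g_k\ge g_1N_k^{1/2}$. For every $k\le K$: * $(ED_0)$: $V_k^2$ is positive definite, $\operatorname{Var}\{\nabla\zeta_k(\theta^*)\}\le V_k^2$, and for all $|\lambda|\le g_k$, $\gamma\ne0$: $\ \log\mathbb E\exp\bigl\{\lambda\frac{\gamma^\top\nabla\zeta_k(\theta^*)}{\|V_k\gamma\|}\bigr\}\le\nu_0^2\lambda^2/2$. * $(ED_1)$: for each $0<r\le r_0$ there is $\varrho_k(r)\in(0,1/2]$ such that for all $\theta\in\Theta_k(r)$, $|\lambda|\le g_k$, $\gamma\ne0$: $\ \log\mathbb E\exp\bigl\{\lambda\frac{\gamma^\top\{\nabla\zeta_k(\theta)-\nabla\zeta_k(\theta^*)\}}{\varrho_k(r)\|V_k\gamma\|}\bigr\}\le\nu_0^2\lambda^2/2$. * $(\mathcal L_0)$: $D_k^2$ is positive definite, and for each $0<r\le r_0$ there is $\delta_k(r)\le1/2$ such that for all $\theta\in\Theta_k(r)$, $\theta\ne\theta^*$: $\ \bigl|\frac{-2\mathbb E L(W^{(k)},\theta,\theta^*)}{\|D_k(\theta-\theta^*)\|^2}-1\bigr|\le\delta_k(r)$.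 Let $\delta,\varrho$ satisfy $\delta\ge\delta_k(r_0)$, $\varrho\ge\varrho_k(r_0)$ and let $D_{\epsilon,k}^2$ be positive definite, for all $k\le K$. **Theorem.** There are constants $C_1,C_2,C,c,c'>0$ that depend only on $\nu_0$ and $g_1$, and for all $r>0$, $g_0>0$ a constant $C_r$ that depends only on $r,p,g_0,\nu_0,g_1$, such that in every setting as above there are random variables $\diamondsuit_k$ (measurable functions of $Y$) and numbers $\mathfrak y_k$ with $cN_k\le\mathfrak y_k\le c'N_k$, $k\le K$, for which: 1. for all $k\le K$ and all $\theta\in\Theta_k(r_0)$ (simultaneously, for every realization of $Y$) $$\mathbb L_-(W^{(k)},\theta,\theta^*)-\diamondsuit_k\le L(W^{(k)},\theta,\theta^*)\le\mathbb L_+(W^{(k)},\theta,\theta^*)+\diamondsuit_k ;$$ 2. for all $k\le K$ and all $\mathtt x>0$ with $C_1\mathtt x+C_2(p+1)\le\mathfrak y_k$ $$\mathbb P_{\theta^*}\bigl(\varrho^{-1}\diamondsuit_k>C_1\mathtt x+C_2(p+1)\bigr)\le C e^{-\mathtt x};$$ 3. for all $r>0$, $g_0>0$ and all $k\le K$ with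 $g_k\ge g_0$: $\ \mathbb E_{\theta^*}\bigl|\varrho^{-1}\diamondsuit_k\bigr|^r\le C_r$, the moment being finite. -/

import Mathlib

open MeasureTheory ProbabilityTheory Matrix

noncomputable section

/-- The check function `ρ_τ(u) = u (τ - 1(u < 0))`. -/
def checkFn (τ u : ℝ) : ℝ := u * (τ - if u < 0 then 1 else 0)

/-- Local polynomial quantile regression of degree `p` at the point `pt`, with `n` independent
observations, a deterministic design, `K` localizing weighting schemes, and a quantile function
which is linear in the polynomial basis with parameter `θs`.  The residual `ε_i` has the Lebesgue
density `dens i`, and its `τ`-quantile is zero. -/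
structure QRModel (p n K : ℕ) where
  τ : ℝ
  τ_pos : 0 < τ
  τ_lt_one : τ < 1
  /-- the point at which the quantile function is estimated -/
  pt : ℝ
  /-- the design points `X_1, …, X_n` -/
  X : Fin n → ℝ
  /-- the weights `w_i^{(k)}` -/
  w : Fin K → Fin n → ℝ
  w_nonneg : ∀ k i, 0 ≤ w k i
  /-- the true parameter `θ*` -/
  θs : Fin (p + 1) → ℝ
  /-- the densities `ℓ_i` of the residuals -/
  dens : Fin n → ℝ → ℝ
  dens_meas : ∀ i, Measurable (dens i)
  dens_nonneg : ∀ i u, 0 ≤ dens i u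
  dens_total : ∀ i, ∫⁻ u, ENNReal.ofReal (dens i u) = 1
  quantile : ∀ i,
    (volume.withDensity fun u => ENNReal.ofReal (dens i u)) (Set.Iio 0) = ENNReal.ofReal τ

namespace QRModel

variable {p n K : ℕ} (M : QRModel p n K)

/-- The basis vector `Ψ_i`, with entries `(X_i - x)^m / m!` for `m = 0, …, p`. -/
def Psi (i : Fin n) : Fin (p + 1) → ℝ :=
  fun m => (M.X i - M.pt) ^ (m : ℕ) / (Nat.factorial (m : ℕ) : ℝ)

/-- The law of the residual `ε_i`. -/
def residLaw (i : Fin n) : Measure ℝ :=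
  volume.withDensity fun u => ENNReal.ofReal (M.dens i u)

/-- The law `ℙ_{θ*}` of `Y = (Y_1, …, Y_n)`, where `Y_i = Ψ_iᵀ θ* + ε_i` are independent. -/
def P : Measure (Fin n → ℝ) :=
  Measure.pi fun i => (M.residLaw i).map fun u => M.Psi i ⬝ᵥ M.θs + u

/-- The local log-likelihood `L(W^{(k)}, θ)` at the observation vector `y`. -/
def L (k : Fin K) (θ : Fin (p + 1) → ℝ) (y : Fin n → ℝ) : ℝ :=
  Real.log (M.τ * (1 - M.τ)) * ∑ i, M.w k i
    - ∑ i, checkFn M.τ (y i - M.Psi i ⬝ᵥ θ) * M.w k i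

/-- The excess `L(W^{(k)}, θ, θ*) = L(W^{(k)}, θ) - L(W^{(k)}, θ*)`. -/
def excess (k : Fin K) (θ : Fin (p + 1) → ℝ) (y : Fin n → ℝ) : ℝ :=
  M.L k θ y - M.L k M.θs y

/-- The score `∇L(W^{(k)}, θ) = ∑ (τ - 1(Y_i - Ψ_iᵀ θ < 0)) Ψ_i w_i^{(k)}`.
It is the derivative in `θ` wherever no residual vanishes (see `hasFDerivAt_L`), hence almost surely
at each fixed `θ`. -/
def score (k : Fin K) (θ : Fin (p + 1) → ℝ) (y : Fin n → ℝ) : Fin (p + 1) → ℝ :=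
  ∑ i, ((M.τ - if y i - M.Psi i ⬝ᵥ θ < 0 then 1 else 0) * M.w k i) • M.Psi i

/-- The centered score `∇ζ_k(θ) = ∇L(W^{(k)}, θ) - 𝔼 ∇L(W^{(k)}, θ)`. -/
def gradZeta (k : Fin K) (θ : Fin (p + 1) → ℝ) (y : Fin n → ℝ) : Fin (p + 1) → ℝ :=
  M.score k θ y - ∫ z, M.score k θ z ∂M.P

/-- `D_k² = ∑ Ψ_i Ψ_iᵀ ℓ_i(0) w_i^{(k)}`. -/
def D2 (k : Fin K) : Matrix (Fin (p + 1)) (Fin (p + 1)) ℝ :=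
  ∑ i, (M.dens i 0 * M.w k i) • vecMulVec (M.Psi i) (M.Psi i)

/-- `V_k² = τ (1 - τ) ∑ Ψ_i Ψ_iᵀ |w_i^{(k)}|²`. -/
def V2 (k : Fin K) : Matrix (Fin (p + 1)) (Fin (p + 1)) ℝ :=
  (M.τ * (1 - M.τ)) • ∑ i, (M.w k i ^ 2) • vecMulVec (M.Psi i) (M.Psi i)

/-- `‖V_k γ‖ = (γᵀ V_k² γ)^{1/2}`. -/
def Vnorm (k : Fin K) (γ : Fin (p + 1) → ℝ) : ℝ :=
  √(γ ⬝ᵥ (M.V2 k *ᵥ γ))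

/-- The local sample size `N_k`, given by
`N_k^{-1/2} = max_i sup_γ |γᵀ Ψ_i| 1(w_i^{(k)} > 0) ‖V_k γ‖⁻¹ (τ (1 - τ))^{1/2}`. -/
def N (k : Fin K) : ℝ :=
  ((⨆ i : Fin n, ⨆ γ : Fin (p + 1) → ℝ,
    |γ ⬝ᵥ M.Psi i| * (if 0 < M.w k i then 1 else 0) / M.Vnorm k γ * √(M.τ * (1 - M.τ))) ^ 2)⁻¹

/-- The local set `Θ_k(r) = {θ : ‖V_k (θ - θ*)‖ ≤ r}`. -/
def Θloc (k : Fin K) (r : ℝ) : Set (Fin (p + 1) → ℝ) :=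
  {θ | M.Vnorm k (θ - M.θs) ≤ r}

/-- `D_{ε,k}² = D_k² (1 - δ) - ϱ V_k²` for `ε = (δ, ϱ)`. -/
def D2eps (k : Fin K) (δ ϱ : ℝ) : Matrix (Fin (p + 1)) (Fin (p + 1)) ℝ :=
  (1 - δ) • M.D2 k - ϱ • M.V2 k

/-- The quadratic process
`𝕃_ε(W^{(k)}, θ, θ*) = (θ - θ*)ᵀ ∇L(W^{(k)}, θ*) - ‖D_{ε,k} (θ - θ*)‖² / 2` for `ε = (δ, ϱ)`.
The lower process belongs to `(-δ, -ϱ)`. -/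
def quadProc (k : Fin K) (δ ϱ : ℝ) (θ : Fin (p + 1) → ℝ) (y : Fin n → ℝ) : ℝ :=
  (θ - M.θs) ⬝ᵥ M.score k M.θs y
    - (θ - M.θs) ⬝ᵥ (M.D2eps k δ ϱ *ᵥ (θ - M.θs)) / 2

/-- Condition `(ED₀)`: `V_k²` is positive definite, it dominates the covariance matrix of
`∇ζ_k(θ*)`, and the normalized `∇ζ_k(θ*)` has sub-Gaussian exponential moments for `|λ| ≤ g`.
(At `γ = 0` the quotient is `0` by convention and the bound is void.) -/
def CondED0 (k : Fin K) (g ν₀ : ℝ) : Prop :=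
  (M.V2 k).PosDef ∧ 0 < g ∧ 1 ≤ ν₀ ∧
  (∀ γ : Fin (p + 1) → ℝ,
    variance (fun y => γ ⬝ᵥ M.gradZeta k M.θs y) M.P ≤ γ ⬝ᵥ (M.V2 k *ᵥ γ)) ∧
  ∀ lam : ℝ, |lam| ≤ g → ∀ γ : Fin (p + 1) → ℝ,
    Real.log (∫ y, Real.exp (lam * ((γ ⬝ᵥ M.gradZeta k M.θs y) / M.Vnorm k γ)) ∂M.P)
      ≤ ν₀ ^ 2 * lam ^ 2 / 2

/-- Condition `(ED₁)`, with the constants `ϱ(r)`, `0 < r ≤ r₀`, given by the function `ϱf`. -/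
def CondED1 (k : Fin K) (r₀ g ν₀ : ℝ) (ϱf : ℝ → ℝ) : Prop :=
  ∀ r : ℝ, 0 < r → r ≤ r₀ → 0 < ϱf r ∧ ϱf r ≤ 1 / 2 ∧
    ∀ θ ∈ M.Θloc k r, ∀ lam : ℝ, |lam| ≤ g → ∀ γ : Fin (p + 1) → ℝ,
      Real.log (∫ y, Real.exp (lam * ((γ ⬝ᵥ (M.gradZeta k θ y - M.gradZeta k M.θs y))
          / (ϱf r * M.Vnorm k γ))) ∂M.P)
        ≤ ν₀ ^ 2 * lam ^ 2 / 2

/-- Condition `(L₀)`, with the constants `δ(r)`, `0 < r ≤ r₀`, given by the function `δf`. -/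
def CondL0 (k : Fin K) (r₀ : ℝ) (δf : ℝ → ℝ) : Prop :=
  (M.D2 k).PosDef ∧
  ∀ r : ℝ, 0 < r → r ≤ r₀ → δf r ≤ 1 / 2 ∧
    ∀ θ ∈ M.Θloc k r, θ ≠ M.θs →
      |(-2 * ∫ y, M.excess k θ y ∂M.P)
          / ((θ - M.θs) ⬝ᵥ (M.D2 k *ᵥ (θ - M.θs))) - 1| ≤ δf r

instance (i : Fin n) : IsProbabilityMeasure (M.residLaw i) :=
  ⟨by simp [residLaw, M.dens_total i]⟩

instance : IsProbabilityMeasure M.P := by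
  have : ∀ i, IsProbabilityMeasure
      ((M.residLaw i).map fun u => M.Psi i ⬝ᵥ M.θs + u) := fun i =>
    Measure.isProbabilityMeasure_map (by fun_prop)
  unfold P
  infer_instance

end QRModel

theorem hasDerivAt_checkFn (τ : ℝ) {u : ℝ} (hu : u ≠ 0) :
    HasDerivAt (checkFn τ) (τ - if u < 0 then 1 else 0) u := by
  rcases lt_or_gt_of_ne hu with h | h
  · have h1 : HasDerivAt (fun v : ℝ => v * (τ - 1)) (τ - 1) u := by
      simpa using (hasDerivAt_id u).mul_const (τ - 1)
    rw [if_pos h]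
    refine h1.congr_of_eventuallyEq ?_
    filter_upwards [Iio_mem_nhds h] with v hv
    have hv' : v < 0 := hv
    simp [checkFn, hv']
  · have h1 : HasDerivAt (fun v : ℝ => v * τ) τ u := by
      simpa using (hasDerivAt_id u).mul_const τ
    rw [if_neg (not_lt.mpr h.le), sub_zero]
    refine h1.congr_of_eventuallyEq ?_
    filter_upwards [Ioi_mem_nhds h] with v hv
    have hv' : ¬ v < 0 := not_lt.mpr (le_of_lt hv)
    simp [checkFn, hv']

/-- Where no residual vanishes, `score` is the gradient of the local log-likelihood in `θ`. -/
theorem QRModel.hasFDerivAt_L {p n K : ℕ} (M : QRModel p n K) (k : Fin K)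
    (θ : Fin (p + 1) → ℝ) (y : Fin n → ℝ) (h : ∀ i, y i - M.Psi i ⬝ᵥ θ ≠ 0) :
    HasFDerivAt (fun η => M.L k η y)
      (∑ m, M.score k θ y m • ContinuousLinearMap.proj (R := ℝ) (φ := fun _ => ℝ) m) θ := by
  have hi : ∀ i, HasFDerivAt (fun η : Fin (p + 1) → ℝ => y i - M.Psi i ⬝ᵥ η)
      (-(∑ m, M.Psi i m • ContinuousLinearMap.proj (R := ℝ) (φ := fun _ => ℝ) m)) θ := by
    intro i
    have h1 : HasFDerivAt (fun η : Fin (p + 1) → ℝ => M.Psi i ⬝ᵥ η)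
        (∑ m, M.Psi i m • ContinuousLinearMap.proj (R := ℝ) (φ := fun _ => ℝ) m) θ := by
      unfold dotProduct
      exact HasFDerivAt.fun_sum fun m _ => (hasFDerivAt_apply m θ).const_mul (M.Psi i m)
    exact h1.const_sub (y i)
  have hs := HasFDerivAt.fun_sum (u := Finset.univ) fun i _ =>
    (((hasDerivAt_checkFn M.τ (h i)).comp_hasFDerivAt θ (hi i)).mul_const (M.w k i))
  have hL := hs.const_sub (Real.log (M.τ * (1 - M.τ)) * ∑ i, M.w k i)
  refine hL.congr_fderiv ?_
  ext v
  simp only [QRModel.score, _root_.neg_apply, _root_.sum_apply,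
    _root_.smul_apply, ContinuousLinearMap.proj_apply, smul_eq_mul,
    Finset.sum_apply, Pi.smul_apply, Finset.sum_mul, Finset.mul_sum, mul_neg, Finset.sum_neg_distrib,
    neg_neg]
  rw [Finset.sum_comm]
  refine Finset.sum_congr rfl fun m _ => Finset.sum_congr rfl fun i _ => ?_
  ring

end

/-!
The excess `L(θ) - L(θ*)` splits into its mean, which by `(L₀)` is `-‖D_k (θ - θ*)‖² / 2` up to the
factor `1 ± δ`, the linear term `(θ - θ*)ᵀ ∇L(θ*)`, whose mean vanishes because the residuals have
`τ`-quantile zero, and a centered remainder `U(θ)` (`QRModel.linErr`).  Both quadratic bounds hold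
with the error `♦_k = sup_θ (|U(θ)| - ϱ ‖V_k (θ - θ*)‖² / 2)₊` (`QRModel.errSup`), the supremum
being over `Θ_k(r₀)`.  What has to be shown is that `♦_k / ϱ` is of the order `x + p + 1` with
probability at least `1 - e⁻ˣ`, however large `r₀` is.

The check function is absolutely continuous, so `U(s) - U(t)` is the integral along the segment from
`t` to `s` of `(s - t)ᵀ (∇ζ_k(θ) - ∇ζ_k(θ*))`, and Jensen's inequality turns `(ED₁)` into
exponential moments of the increments of `U / ϱ` with respect to `‖V_k ·‖`
(`QRModel.lintegral_exp_abs_linErr_le`).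

The chaining uses averages instead of nets.  For a convex set `B` and `θ ∈ B` let `f_j` be the
average of `f` over the contraction `(1 - 2⁻ʲ) θ + 2⁻ʲ B`.  By concavity of the logarithm
`|f_j - f_{j+1}|` is at most `2⁻ʲ diam B / lam` times the logarithm of
`∬ exp(lam |f s - f t| / N(s - t))` over `B × B` plus a term `(2 j + 1) dim log 2` that accounts for
the volumes of the contracted sets.  The sum over `j` converges, and bounds `f(θ) - f_0` uniformly
in `θ` by one random variable whose mean is controlled (`abs_sub_average_le`).

Applied to the balls of radius `2ᵐ b`, `m = 0, 1, …`, and averaged over `m` with the weights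
`2⁻⁽ᵐ⁺¹⁾`, this yields a single `Z ≥ 1` with `𝔼 Z ≤ 2 exp(ν² lam² / 2)` such that
`|U(θ)| / ϱ ≤ 2ᵐ b (m + 1) T` on the `m`-th ball, where `T = 23 (log Z + dim) / lam`; the penalty,
of the order `4ᵐ b²`, leaves `b T + 2592 T⁴ / b²` (`exists_penalized_bound`).  The deviation bound
follows with `b = lam = √(x + p + 1)` and Markov's inequality; this choice of `lam` is admissible as
long as `x + p + 1 ≤ g_k²`, whence the range determined by `N_k`.  The moment bound follows with
`b = 1` and `lam = min g₀ 1`, since powers of `log Z` are dominated by `Z`.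
-/

/-! ### Chaining through averages over shrinking convex sets -/

section Chaining

variable {E : Type*} [NormedAddCommGroup E] [NormedSpace ℝ E] [FiniteDimensional ℝ E]
  [MeasurableSpace E] [BorelSpace E] {vol : Measure E} [vol.IsAddHaarMeasure]

/-- A contraction `u ↦ (1 - a) θ + a u` of a convex set `B` towards one of its points distorts the
uniform distribution on `B` by a density of at most `a ^ (-dim)`. -/
theorem lintegral_cond_contraction_le {B : Set E} (hBm : MeasurableSet B) (hB : Convex ℝ B)
    {θ : E} (hθ : θ ∈ B) {a : ℝ} (ha0 : 0 < a) (ha1 : a ≤ 1) {f : E → ENNReal}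
    (hf : Measurable f) :
    ∫⁻ u, f ((1 - a) • θ + a • u) ∂vol[|B]
      ≤ ENNReal.ofReal (a⁻¹ ^ Module.finrank ℝ E) * ∫⁻ u, f u ∂vol[|B] := by
  have hfi : Measurable (B.indicator f) := hf.indicator hBm
  have key : ∫⁻ u in B, f ((1 - a) • θ + a • u) ∂vol
      ≤ ENNReal.ofReal (a⁻¹ ^ Module.finrank ℝ E) * ∫⁻ u in B, f u ∂vol := by
    calc ∫⁻ u in B, f ((1 - a) • θ + a • u) ∂vol
        = ∫⁻ u in B, B.indicator f (a • u + (1 - a) • θ) ∂vol := by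
          refine setLIntegral_congr_fun hBm fun u hu => ?_
          have : (1 - a) • θ + a • u ∈ B :=
            hB hθ hu (by linarith) ha0.le (by ring)
          rw [add_comm] at this
          simp only [Set.indicator_of_mem this, add_comm]
      _ ≤ ∫⁻ u, B.indicator f (a • u + (1 - a) • θ) ∂vol := setLIntegral_le_lintegral _ _
      _ = ∫⁻ v, B.indicator f (v + (1 - a) • θ) ∂(vol.map fun u => a • u) := by
          rw [lintegral_map (f := fun v => B.indicator f (v + (1 - a) • θ))
            (hfi.comp (measurable_add_const _)) (measurable_const_smul a)]
      _ = ENNReal.ofReal (a⁻¹ ^ Module.finrank ℝ E) * ∫⁻ u in B, f u ∂vol := by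
          rw [Measure.map_addHaar_smul vol ha0.ne', lintegral_smul_measure,
            lintegral_add_right_eq_self (μ := vol) (B.indicator f), lintegral_indicator hBm,
            abs_of_pos (by positivity), inv_pow, smul_eq_mul]
  simp only [ProbabilityTheory.cond, lintegral_smul_measure, smul_eq_mul]
  rw [mul_left_comm]
  gcongr

theorem lintegral_lintegral_cond_contraction_le {B : Set E} (hBm : MeasurableSet B)
    (hB : Convex ℝ B) {θ : E} (hθ : θ ∈ B) {a b : ℝ} (ha0 : 0 < a) (ha1 : a ≤ 1)
    (hb0 : 0 < b) (hb1 : b ≤ 1) {F : E → E → ENNReal} (hF : Measurable (Function.uncurry F)) :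
    ∫⁻ u, ∫⁻ v, F ((1 - a) • θ + a • u) ((1 - b) • θ + b • v) ∂vol[|B] ∂vol[|B]
      ≤ ENNReal.ofReal (b⁻¹ ^ Module.finrank ℝ E) *
        (ENNReal.ofReal (a⁻¹ ^ Module.finrank ℝ E) *
          ∫⁻ u, ∫⁻ v, F u v ∂vol[|B] ∂vol[|B]) := by
  have hs : SFinite (vol[|B]) := by unfold ProbabilityTheory.cond; infer_instance
  have hH : Measurable fun s => ∫⁻ v, F s v ∂vol[|B] := Measurable.lintegral_prod_right hF
  calc _ ≤ ∫⁻ u, ENNReal.ofReal (b⁻¹ ^ Module.finrank ℝ E) *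
            ∫⁻ v, F ((1 - a) • θ + a • u) v ∂vol[|B] ∂vol[|B] :=
        lintegral_mono fun u => lintegral_cond_contraction_le hBm hB hθ hb0 hb1
          (hF.comp measurable_prodMk_left)
    _ = ENNReal.ofReal (b⁻¹ ^ Module.finrank ℝ E) *
          ∫⁻ u, (fun s => ∫⁻ v, F s v ∂vol[|B]) ((1 - a) • θ + a • u) ∂vol[|B] := by
        rw [lintegral_const_mul' _ _ ENNReal.ofReal_ne_top]
    _ ≤ _ := by
        gcongr
        exact lintegral_cond_contraction_le hBm hB hθ ha0 ha1 hH

/-- The exponential oscillation `∬ exp(lam |f s - f t| / N(s - t)) μ(ds) μ(dt)` of a function `f`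
relative to the seminorm `N`.  The quotient is `0` where `N (s - t) = 0`. -/
noncomputable def expOsc (N : Seminorm ℝ E) (lam : ℝ) (μ : Measure E) (f : E → ℝ) : ENNReal :=
  ∫⁻ s, ∫⁻ t, ENNReal.ofReal (Real.exp (lam * (|f s - f t| / N (s - t)))) ∂μ ∂μ

/-- A form of Jensen's inequality for the logarithm: if `𝔼 exp x ≤ W` then `𝔼 x ≤ log W`. -/
theorem integral_le_log_of_integral_exp_le {Ω : Type*} [MeasurableSpace Ω] {P : Measure Ω}
    [IsProbabilityMeasure P] {x : Ω → ℝ} {W : ℝ} (hW : 0 < W) (hx : Integrable x P)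
    (hex : Integrable (fun ω => Real.exp (x ω)) P) (h : ∫ ω, Real.exp (x ω) ∂P ≤ W) :
    ∫ ω, x ω ∂P ≤ Real.log W := by
  have h1 : ∀ ω, x ω ≤ Real.log W - 1 + W⁻¹ * Real.exp (x ω) := fun ω => by
    have := Real.add_one_le_exp (x ω - Real.log W)
    rw [Real.exp_sub, Real.exp_log hW, div_eq_inv_mul] at this
    linarith
  calc ∫ ω, x ω ∂P ≤ ∫ ω, (Real.log W - 1 + W⁻¹ * Real.exp (x ω)) ∂P :=
        integral_mono hx ((integrable_const _).add (hex.const_mul _)) h1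
    _ = Real.log W - 1 + W⁻¹ * ∫ ω, Real.exp (x ω) ∂P := by
        rw [integral_add (integrable_const _) (hex.const_mul _), integral_const_mul]
        simp
    _ ≤ Real.log W - 1 + W⁻¹ * W := by gcongr
    _ = Real.log W := by rw [inv_mul_cancel₀ hW.ne']; ring

/-- One link of the chain: averages of `f` over the two contractions of `B` towards `θ` by the
factors `a` and `b ≤ a` differ by at most the diameter `2 R a` of the larger one, times a logarithm
of the exponential oscillation that pays for the volume of the two contracted sets. -/
theorem abs_integral_contraction_sub_le {B : Set E} (hBm : MeasurableSet B)
    (hB : Convex ℝ B) (h0 : vol B ≠ 0) (htop : vol B ≠ ⊤) {N : Seminorm ℝ E} (hN : Measurable N)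
    {R : ℝ} (hR : ∀ s ∈ B, ∀ t ∈ B, N (s - t) ≤ 2 * R) {f : E → ℝ} (hf : Measurable f)
    {L : ℝ} (hL : ∀ s t, |f s - f t| ≤ L * N (s - t)) (hL0 : 0 ≤ L) {lam : ℝ} (hlam : 0 < lam)
    {ζ : ℝ} (hζ : 0 < ζ) (hosc : expOsc N lam (vol[|B]) f ≤ ENNReal.ofReal ζ)
    {θ : E} (hθ : θ ∈ B) {a b : ℝ} (hb0 : 0 < b) (hba : b ≤ a) (ha1 : a ≤ 1) :
    |∫ u, f ((1 - a) • θ + a • u) ∂vol[|B] - ∫ u, f ((1 - b) • θ + b • u) ∂vol[|B]|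
      ≤ 2 * R * a / lam * (Real.log ζ + Module.finrank ℝ E * (Real.log a⁻¹ + Real.log b⁻¹)) := by
  have ha0 : 0 < a := hb0.trans_le hba
  have hb1 : b ≤ 1 := hba.trans ha1
  set d := Module.finrank ℝ E
  set μ := vol[|B] with hμ
  have : IsProbabilityMeasure μ := cond_isProbabilityMeasure_of_finite h0 htop
  have haeB : ∀ᵐ u ∂μ, u ∈ B := ae_cond_mem hBm
  set Ta : E → E := fun u => (1 - a) • θ + a • u with hTa
  set Tb : E → E := fun u => (1 - b) • θ + b • u with hTb
  have hTam : Measurable Ta := by fun_prop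
  have hTbm : Measurable Tb := by fun_prop
  have hint : ∀ c : ℝ, 0 ≤ c → c ≤ 1 → Integrable (fun u => f ((1 - c) • θ + c • u)) μ := by
    intro c hc0 hc1
    refine Integrable.of_bound (hf.comp (by fun_prop)).aestronglyMeasurable
      (|f θ| + L * (2 * R)) ?_
    filter_upwards [haeB] with u hu
    have hmem : (1 - c) • θ + c • u ∈ B := hB hθ hu (by linarith) hc0 (by ring)
    have h1 := hL ((1 - c) • θ + c • u) θ
    have h2 := mul_le_mul_of_nonneg_left (hR _ hmem _ hθ) hL0
    rw [Real.norm_eq_abs]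
    have h3 := abs_sub_abs_le_abs_sub (f ((1 - c) • θ + c • u)) (f θ)
    linarith
  -- the normalized increment
  set x : E × E → ℝ := fun q => lam * (|f (Ta q.1) - f (Tb q.2)| / N (Ta q.1 - Tb q.2)) with hx
  have hxm : Measurable x := by fun_prop
  have hx0 : ∀ q, 0 ≤ x q := fun q => by
    have := apply_nonneg N (Ta q.1 - Tb q.2)
    positivity
  have hxL : ∀ q, x q ≤ lam * L := fun q =>
    mul_le_mul_of_nonneg_left (div_le_of_le_mul₀ (apply_nonneg _ _) hL0 (hL _ _)) hlam.le
  have hxi : Integrable x (μ.prod μ) :=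
    Integrable.of_bound hxm.aestronglyMeasurable (lam * L)
      (.of_forall fun q => by rw [Real.norm_eq_abs, abs_of_nonneg (hx0 q)]; exact hxL q)
  have hexi : Integrable (fun q => Real.exp (x q)) (μ.prod μ) :=
    Integrable.of_bound (by fun_prop) (Real.exp (lam * L))
      (.of_forall fun q => by
        rw [Real.norm_eq_abs, abs_of_nonneg (Real.exp_pos _).le]
        exact Real.exp_le_exp.2 (hxL q))
  have hW : 0 < b⁻¹ ^ d * (a⁻¹ ^ d * ζ) := by positivity
  have hexp : ∫ q, Real.exp (x q) ∂μ.prod μ ≤ b⁻¹ ^ d * (a⁻¹ ^ d * ζ) := by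
    rw [integral_eq_lintegral_of_nonneg_ae (.of_forall fun q => (Real.exp_pos _).le)
      (by fun_prop)]
    refine ENNReal.toReal_le_of_le_ofReal hW.le ?_
    rw [lintegral_prod _ (by fun_prop)]
    refine (lintegral_lintegral_cond_contraction_le hBm hB hθ ha0 ha1 hb0 hb1
      (F := fun s t => ENNReal.ofReal (Real.exp (lam * (|f s - f t| / N (s - t)))))
      (by unfold Function.uncurry; fun_prop)).trans ?_
    rw [ENNReal.ofReal_mul (by positivity), ENNReal.ofReal_mul (by positivity)]
    gcongr
    exact hosc
  have hlog := integral_le_log_of_integral_exp_le hW hxi hexi hexp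
  rw [Real.log_mul (by positivity) (by positivity), Real.log_mul (by positivity) hζ.ne',
    Real.log_pow, Real.log_pow] at hlog
  have hRa : 0 ≤ 2 * R * a / lam := by
    have : 0 ≤ 2 * R := (apply_nonneg N _).trans (hR θ hθ θ hθ)
    positivity
  have hinta := hint a ha0.le ha1
  have hintb := hint b hb0.le hb1
  have hpa : Integrable (fun q : E × E => f (Ta q.1)) (μ.prod μ) := hinta.comp_fst μ
  have hpb : Integrable (fun q : E × E => f (Tb q.2)) (μ.prod μ) := hintb.comp_snd μ
  -- both contractions map into the larger one, `θ + a (B - θ)`, whose diameter is at most `2 R a`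
  have hpt : ∀ᵐ q ∂μ.prod μ, |f (Ta q.1) - f (Tb q.2)| ≤ 2 * R * a / lam * x q := by
    have h1 : ∀ᵐ q ∂μ.prod μ, q.1 ∈ B := Measure.quasiMeasurePreserving_fst.ae haeB
    have h2 : ∀ᵐ q ∂μ.prod μ, q.2 ∈ B := Measure.quasiMeasurePreserving_snd.ae haeB
    filter_upwards [h1, h2] with q hq1 hq2
    set v : E := (1 - b / a) • θ + (b / a) • q.2 with hv
    have hvB : v ∈ B := hB hθ hq2 (by rw [sub_nonneg, div_le_one ha0]; exact hba)
      (by positivity) (by ring)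
    have hdiff : Ta q.1 - Tb q.2 = a • (q.1 - v) := by
      have : a * (b / a) = b := by field_simp
      simp only [hTa, hTb, hv, smul_sub, smul_add, smul_smul, this, mul_one, sub_smul]
      module
    have hNle : N (Ta q.1 - Tb q.2) ≤ 2 * R * a := by
      rw [hdiff, map_smul_eq_mul, Real.norm_eq_abs, abs_of_pos ha0]
      have := mul_le_mul_of_nonneg_left (hR _ hq1 _ hvB) ha0.le
      linarith
    have hN0 := apply_nonneg N (Ta q.1 - Tb q.2)
    rcases hN0.eq_or_lt with h | h
    · have := hL (Ta q.1) (Tb q.2)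
      rw [← h, mul_zero] at this
      exact this.trans (mul_nonneg hRa (hx0 q))
    · calc |f (Ta q.1) - f (Tb q.2)|
          = N (Ta q.1 - Tb q.2) * (|f (Ta q.1) - f (Tb q.2)| / N (Ta q.1 - Tb q.2)) := by
            field_simp
        _ ≤ 2 * R * a * (|f (Ta q.1) - f (Tb q.2)| / N (Ta q.1 - Tb q.2)) := by gcongr
        _ = 2 * R * a / lam * x q := by simp only [hx]; field_simp
  have e1 : ∫ u, f ((1 - a) • θ + a • u) ∂μ = ∫ q, f (Ta q.1) ∂μ.prod μ := by
    rw [integral_fun_fst (fun u => f (Ta u))]; simp [hTa]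
  have e2 : ∫ u, f ((1 - b) • θ + b • u) ∂μ = ∫ q, f (Tb q.2) ∂μ.prod μ := by
    rw [integral_fun_snd (fun u => f (Tb u))]; simp [hTb]
  rw [e1, e2, ← integral_sub hpa hpb]
  calc |∫ q, (f (Ta q.1) - f (Tb q.2)) ∂μ.prod μ|
      ≤ ∫ q, |f (Ta q.1) - f (Tb q.2)| ∂μ.prod μ := abs_integral_le_integral_abs
    _ ≤ ∫ q, 2 * R * a / lam * x q ∂μ.prod μ :=
        integral_mono_ae (hpa.sub hpb).abs (hxi.const_mul _) hpt
    _ = 2 * R * a / lam * ∫ q, x q ∂μ.prod μ := integral_const_mul _ _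
    _ ≤ _ := by
        refine mul_le_mul_of_nonneg_left (hlog.trans (le_of_eq ?_)) hRa
        ring

/-- Chaining along the contractions by `2⁻ʲ`: a Lipschitz function deviates from its average over a
convex set by at most the logarithm of its exponential oscillation plus a multiple of the
dimension. -/
theorem abs_sub_average_le {B : Set E} (hBm : MeasurableSet B)
    (hB : Convex ℝ B) (h0 : vol B ≠ 0) (htop : vol B ≠ ⊤) {N : Seminorm ℝ E} (hN : Measurable N)
    {R : ℝ} (hR : ∀ s ∈ B, ∀ t ∈ B, N (s - t) ≤ 2 * R) {f : E → ℝ} (hf : Measurable f)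
    {L : ℝ} (hL : ∀ s t, |f s - f t| ≤ L * N (s - t)) (hL0 : 0 ≤ L) {lam : ℝ} (hlam : 0 < lam)
    {ζ : ℝ} (hζ1 : 1 ≤ ζ) (hosc : expOsc N lam (vol[|B]) f ≤ ENNReal.ofReal ζ)
    {θ : E} (hθ : θ ∈ B) :
    |f θ - ∫ u, f u ∂vol[|B]|
      ≤ 2 * R / lam * (2 * Real.log ζ + 6 * Module.finrank ℝ E * Real.log 2) := by
  set d := Module.finrank ℝ E
  set μ := vol[|B] with hμ
  have : IsProbabilityMeasure μ := cond_isProbabilityMeasure_of_finite h0 htop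
  have haeB : ∀ᵐ u ∂μ, u ∈ B := ae_cond_mem hBm
  have hR0 : 0 ≤ 2 * R := (apply_nonneg N _).trans (hR θ hθ θ hθ)
  set A : ℕ → ℝ := fun j => ∫ u, f ((1 - (2⁻¹ : ℝ) ^ j) • θ + (2⁻¹ : ℝ) ^ j • u) ∂μ with hA
  have hA0 : A 0 = ∫ u, f u ∂μ := by simp [hA]
  have hlog2 : 0 < Real.log 2 := Real.log_pos one_lt_two
  have hlogζ : 0 ≤ Real.log ζ := Real.log_nonneg hζ1
  have hlink : ∀ j, |A j - A (j + 1)|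
      ≤ 2 * R / lam * ((2⁻¹ : ℝ) ^ j * (Real.log ζ + (2 * j + 1) * (d * Real.log 2))) := by
    intro j
    have := abs_integral_contraction_sub_le hBm hB h0 htop hN hR hf hL hL0 hlam (one_pos.trans_le hζ1) hosc hθ
      (a := (2⁻¹ : ℝ) ^ j) (b := (2⁻¹ : ℝ) ^ (j + 1)) (by positivity)
      (pow_le_pow_of_le_one (by norm_num) (by norm_num) (Nat.le_succ j))
      (pow_le_one₀ (by norm_num) (by norm_num))
    refine this.trans (le_of_eq ?_)
    simp only [← inv_pow, inv_inv, Real.log_pow]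
    push_cast
    ring
  -- the closed form of the partial sums of the bounds in `hlink`
  have hchain : ∀ J, |A 0 - A J| ≤ 2 * R / lam *
      (2 * Real.log ζ + 6 * (d * Real.log 2)
        - (2⁻¹ : ℝ) ^ J * (2 * Real.log ζ + (4 * J + 6) * (d * Real.log 2))) := by
    intro J
    induction J with
    | zero => simp
    | succ J ih =>
      have h1 : |A 0 - A (J + 1)| ≤ |A 0 - A J| + |A J - A (J + 1)| := abs_sub_le _ _ _
      refine h1.trans ((add_le_add ih (hlink J)).trans (le_of_eq ?_))
      push_cast
      ring
  have hnear : ∀ J, |f θ - A J| ≤ L * (2 * R) * (2⁻¹ : ℝ) ^ J := by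
    intro J
    set c := (2⁻¹ : ℝ) ^ J with hc
    have hc0 : 0 < c := by positivity
    have hc1 : c ≤ 1 := pow_le_one₀ (by norm_num) (by norm_num)
    have hb : ∀ᵐ u ∂μ, ‖f ((1 - c) • θ + c • u) - f θ‖ ≤ L * (2 * R) * c := by
      filter_upwards [haeB] with u hu
      have h1 := hL ((1 - c) • θ + c • u) θ
      have h2 : (1 - c) • θ + c • u - θ = c • (u - θ) := by module
      rw [h2, map_smul_eq_mul, Real.norm_eq_abs, abs_of_pos hc0] at h1
      refine h1.trans ?_
      have := mul_le_mul_of_nonneg_left (mul_le_mul_of_nonneg_left (hR u hu θ hθ) hc0.le) hL0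
      linarith
    have hi : Integrable (fun u => f ((1 - c) • θ + c • u) - f θ) μ :=
      Integrable.of_bound (Measurable.aestronglyMeasurable (by fun_prop)) _ hb
    have hi' : Integrable (fun u => f ((1 - c) • θ + c • u)) μ := by
      exact (hi.add (integrable_const (f θ))).congr (.of_forall fun u => by simp)
    have : A J - f θ = ∫ u, (f ((1 - c) • θ + c • u) - f θ) ∂μ := by
      rw [integral_sub hi' (integrable_const _)]; simp [hA, hc]
    rw [abs_sub_comm, this, ← Real.norm_eq_abs]
    refine (norm_integral_le_of_norm_le_const hb).trans (by simp)
  have hlim : Filter.Tendsto (fun J : ℕ => L * (2 * R) * (2⁻¹ : ℝ) ^ J +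
      2 * R / lam * (2 * Real.log ζ + 6 * (d * Real.log 2))) Filter.atTop
      (nhds (L * (2 * R) * 0 + 2 * R / lam * (2 * Real.log ζ + 6 * (d * Real.log 2)))) :=
    ((tendsto_pow_atTop_nhds_zero_of_lt_one (by norm_num) (by norm_num)).const_mul _).add_const _
  rw [← hA0]
  refine (ge_of_tendsto' hlim fun J => ?_).trans (le_of_eq (by ring))
  have h1 : |f θ - A 0| ≤ |f θ - A J| + |A J - A 0| := abs_sub_le _ _ _
  have h2 := hchain J
  rw [abs_sub_comm] at h2
  have h3 : 0 ≤ 2 * R / lam *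
      ((2⁻¹ : ℝ) ^ J * (2 * Real.log ζ + (4 * J + 6) * (d * Real.log 2))) := by positivity
  have h4 := hnear J
  linarith

end Chaining

/-! ### A random process minus a quadratic penalty -/

section Penalized

variable {E : Type*} [NormedAddCommGroup E] [NormedSpace ℝ E] [FiniteDimensional ℝ E]
  [MeasurableSpace E] [BorelSpace E]

omit [FiniteDimensional ℝ E] [BorelSpace E] in
theorem one_le_expOsc {N : Seminorm ℝ E} {lam : ℝ} (hlam : 0 < lam) {μ : Measure E}
    [IsProbabilityMeasure μ] {f : E → ℝ} : 1 ≤ expOsc N lam μ f := by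
  calc (1 : ENNReal) = ∫⁻ _, ∫⁻ _, 1 ∂μ ∂μ := by simp
    _ ≤ expOsc N lam μ f := by
      refine lintegral_mono fun s => lintegral_mono fun t => ?_
      rw [← ENNReal.ofReal_one]
      refine ENNReal.ofReal_le_ofReal (Real.one_le_exp ?_)
      have := apply_nonneg N (s - t)
      positivity

omit [FiniteDimensional ℝ E] [BorelSpace E] in
theorem expOsc_le_of_lipschitz {N : Seminorm ℝ E} {lam : ℝ} (hlam : 0 < lam) {μ : Measure E}
    [IsProbabilityMeasure μ] {f : E → ℝ} {L : ℝ} (hL : ∀ s t, |f s - f t| ≤ L * N (s - t))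
    (hL0 : 0 ≤ L) : expOsc N lam μ f ≤ ENNReal.ofReal (Real.exp (lam * L)) := by
  calc expOsc N lam μ f ≤ ∫⁻ _, ∫⁻ _, ENNReal.ofReal (Real.exp (lam * L)) ∂μ ∂μ := by
        refine lintegral_mono fun s => lintegral_mono fun t => ?_
        gcongr
        exact div_le_of_le_mul₀ (apply_nonneg _ _) hL0 (hL _ _)
    _ = _ := by simp

section Expectation

variable {Ω : Type*} [MeasurableSpace Ω] {P : Measure Ω}

theorem measurable_expOsc {N : Seminorm ℝ E} (hN : Measurable N) {lam : ℝ} {μ : Measure E}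
    [SFinite μ] {U : E → Ω → ℝ} (hU : Measurable (Function.uncurry U)) :
    Measurable fun ω => expOsc N lam μ fun θ => U θ ω := by
  unfold expOsc
  refine Measurable.lintegral_prod_right (f := fun ω s => _) ?_
  unfold Function.uncurry
  refine Measurable.lintegral_prod_right (f := fun (z : Ω × E) t => _) ?_
  unfold Function.uncurry
  have h2 : Measurable fun z : (Ω × E) × E => U z.1.2 z.1.1 :=
    hU.comp ((measurable_snd.comp measurable_fst).prodMk (measurable_fst.comp measurable_fst))
  have h3 : Measurable fun z : (Ω × E) × E => U z.2 z.1.1 :=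
    hU.comp (measurable_snd.prodMk (measurable_fst.comp measurable_fst))
  fun_prop

/-- The expected exponential oscillation is controlled by the exponential moments of the
increments, by Tonelli's theorem. -/
theorem lintegral_expOsc_le [SFinite P] {N : Seminorm ℝ E} (hN : Measurable N) {lam : ℝ}
    {μ : Measure E} [IsProbabilityMeasure μ] {U : E → Ω → ℝ}
    (hU : Measurable (Function.uncurry U)) {B : Set E} (hB : ∀ᵐ s ∂μ, s ∈ B) {c : ENNReal}
    (h : ∀ s ∈ B, ∀ t ∈ B,
      ∫⁻ ω, ENNReal.ofReal (Real.exp (lam * (|U s ω - U t ω| / N (s - t)))) ∂P ≤ c) :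
    ∫⁻ ω, expOsc N lam μ (fun θ => U θ ω) ∂P ≤ c := by
  unfold expOsc
  have h2 : Measurable fun z : (Ω × E) × E => U z.1.2 z.1.1 :=
    hU.comp ((measurable_snd.comp measurable_fst).prodMk (measurable_fst.comp measurable_fst))
  have h3 : Measurable fun z : (Ω × E) × E => U z.2 z.1.1 :=
    hU.comp (measurable_snd.prodMk (measurable_fst.comp measurable_fst))
  rw [lintegral_lintegral_swap]
  · calc _ ≤ ∫⁻ s, c ∂μ := by
          refine lintegral_mono_ae ?_
          filter_upwards [hB] with s hs
          rw [lintegral_lintegral_swap]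
          · calc _ ≤ ∫⁻ t, c ∂μ := by
                  refine lintegral_mono_ae ?_
                  filter_upwards [hB] with t ht
                  exact h s hs t ht
              _ = c := by simp
          · unfold Function.uncurry
            have h4 : Measurable fun z : Ω × E => U s z.1 :=
              hU.comp (measurable_const.prodMk measurable_fst)
            have h5 : Measurable fun z : Ω × E => U z.2 z.1 :=
              hU.comp (measurable_snd.prodMk measurable_fst)
            exact Measurable.aemeasurable (by fun_prop)
      _ = c := by simp
  · unfold Function.uncurry
    refine Measurable.aemeasurable ?_
    refine Measurable.lintegral_prod_right (f := fun (z : Ω × E) t => _) ?_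
    unfold Function.uncurry
    fun_prop

end Expectation

/-- The exponential oscillations of `f` over the balls of radius `min (b 2ᵐ) r₀` around `θs`, with
respect to the uniform distributions and averaged over `m` with the weights `2⁻⁽ᵐ⁺¹⁾`. -/
noncomputable def multiscaleOsc (N : Seminorm ℝ E) (vol : Measure E) (θs : E) (r₀ b lam : ℝ)
    (f : E → ℝ) : ENNReal :=
  ∑' m : ℕ, (2⁻¹ : ENNReal) ^ (m + 1) *
    expOsc N lam (vol[|N.closedBall θs (min (b * 2 ^ m) r₀)]) f

theorem tsum_two_inv_pow_succ : ∑' m : ℕ, (2⁻¹ : ENNReal) ^ (m + 1) = 1 := by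
  rw [ENNReal.tsum_geometric_add_one, ENNReal.one_sub_inv_two, inv_inv]
  exact ENNReal.inv_mul_cancel (by norm_num) (by norm_num)

/-- Optimization over the scale `2ᵐ b`: the quadratic penalty `ρ² / 2`, where `ρ` is of the order
`2ᵐ b`, beats a linear growth up to a logarithmic factor. -/
theorem sub_sq_half_le_of_dyadic {m : ℕ} {b T v ρ : ℝ} (hb : 0 < b) (hT : 0 ≤ T)
    (hv : v ≤ b * 2 ^ m * (m + 1) * T) (hρ : m = 0 ∨ b * 2 ^ m / 2 < ρ) :
    v - ρ ^ 2 / 2 ≤ b * T + 2592 * T ^ 4 / b ^ 2 := by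
  have hbT : 0 ≤ b * T := by positivity
  have hT4 : 0 ≤ 2592 * T ^ 4 / b ^ 2 := by positivity
  rcases hρ with rfl | hρ
  · simp only [pow_zero, mul_one, Nat.cast_zero, zero_add] at hv
    nlinarith [sq_nonneg ρ]
  set α := b * 2 ^ m with hα
  have hα0 : 0 < α := by positivity
  have hsq : (α / 2) ^ 2 ≤ ρ ^ 2 := by gcongr
  set k : ℝ := (m : ℝ) + 1 with hk
  have hk1 : 1 ≤ k := by simp [hk]
  -- `9 / 4` is attained at `m = 2`
  have hpow : k ^ 2 ≤ 9 / 4 * 2 ^ m := by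
    rcases lt_or_ge m 2 with h | h
    · interval_cases m <;> norm_num [hk]
    · clear_value α
      simp only [hk]
      clear hv hsq hρ hα hk hk1 k
      induction m, h using Nat.le_induction with
      | base => norm_num
      | succ m h ih =>
        have : (2 : ℝ) ≤ m := by exact_mod_cast h
        push_cast
        rw [pow_succ (2 : ℝ) m]
        nlinarith
  -- if `α ≥ 8 k T`, the penalty wins; otherwise `hpow` bounds `k` by a multiple of `T / b`
  by_cases hc : 8 * (k * T) ≤ α
  · have : α * k * T ≤ α ^ 2 / 8 := by nlinarith
    nlinarith
  · push Not at hc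
    have h1 : b * k ≤ 18 * T := by
      have h2 : b * k ^ 2 ≤ 9 / 4 * α := by
        have := mul_le_mul_of_nonneg_left hpow hb.le
        linarith
      have h3 : (b * k) * k ≤ (18 * T) * k := by nlinarith
      exact le_of_mul_le_mul_right h3 (by linarith)
    have h4 : α * k * T ≤ 8 * (k * T) ^ 2 := by
      have : 0 ≤ k * T := by positivity
      nlinarith
    have h5 : 8 * (k * T) ^ 2 ≤ 2592 * T ^ 4 / b ^ 2 := by
      rw [le_div_iff₀ (by positivity)]
      have h6 : (b * k) ^ 2 ≤ (18 * T) ^ 2 := by gcongr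
      calc 8 * (k * T) ^ 2 * b ^ 2 = 8 * T ^ 2 * (b * k) ^ 2 := by ring
        _ ≤ 8 * T ^ 2 * (18 * T) ^ 2 := by gcongr
        _ = _ := by ring
    nlinarith [sq_nonneg ρ]

variable {vol : Measure E} [vol.IsAddHaarMeasure]

omit [FiniteDimensional ℝ E] [BorelSpace E] in
theorem addHaar_seminormClosedBall_ne_zero {N : Seminorm ℝ E} (hN : Continuous N) (θs : E) {r : ℝ}
    (hr : 0 < r) : vol (N.closedBall θs r) ≠ 0 := by
  have hopen : IsOpen {θ | N (θ - θs) < r} := isOpen_lt (by fun_prop) continuous_const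
  refine (hopen.measure_pos vol ⟨θs, by simpa using hr⟩).ne' ∘ fun h => measure_mono_null ?_ h
  intro θ hθ
  rw [Seminorm.mem_closedBall]
  exact le_of_lt hθ

omit [BorelSpace E] in
theorem addHaar_seminormClosedBall_ne_top {N : Seminorm ℝ E} {κ : ℝ} (hκ0 : 0 ≤ κ)
    (hκ : ∀ γ, ‖γ‖ ≤ κ * N γ) (θs : E) (r : ℝ) : vol (N.closedBall θs r) ≠ ⊤ := by
  refine ne_top_of_le_ne_top (measure_closedBall_lt_top (x := θs) (r := κ * r)).ne
    (measure_mono fun θ hθ => ?_)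
  rw [Seminorm.mem_closedBall] at hθ
  rw [mem_closedBall_iff_norm]
  exact (hκ _).trans (by gcongr)

omit [FiniteDimensional ℝ E] in
theorem measurableSet_seminormClosedBall {N : Seminorm ℝ E} (hN : Continuous N) (θs : E) (r : ℝ) :
    MeasurableSet (N.closedBall θs r) := by
  have : N.closedBall θs r = {θ | N (θ - θs) ≤ r} := by
    ext; rw [Seminorm.mem_closedBall]; rfl
  rw [this]
  exact (isClosed_le (by fun_prop) continuous_const).measurableSet

/-- A penalized process is bounded in terms of its multiscale exponential oscillation alone: chain
within the ball whose radius is of the order of `N (θ - θs)`, and let the penalty absorb the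
radius. -/
theorem abs_sub_sq_half_le_of_multiscaleOsc [Nontrivial E] {N : Seminorm ℝ E}
    (hN : Continuous N) {κ : ℝ} (hκ0 : 0 ≤ κ) (hκ : ∀ γ, ‖γ‖ ≤ κ * N γ) {θs : E} {r₀ b lam : ℝ}
    (hr₀ : 0 < r₀) (hb : 0 < b) (hlam : 0 < lam) {f : E → ℝ} (hf : Measurable f) (hf0 : f θs = 0)
    {L : ℝ} (hL : ∀ s t, |f s - f t| ≤ L * N (s - t)) (hL0 : 0 ≤ L)
    {ζ : ℝ} (hζ1 : 1 ≤ ζ) (hζ : multiscaleOsc N vol θs r₀ b lam f ≤ ENNReal.ofReal ζ)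
    {θ : E} (hθ : N (θ - θs) ≤ r₀) :
    |f θ| - N (θ - θs) ^ 2 / 2 ≤
      b * (23 * (Real.log ζ + Module.finrank ℝ E) / lam)
        + 2592 * (23 * (Real.log ζ + Module.finrank ℝ E) / lam) ^ 4 / b ^ 2 := by
  set d := Module.finrank ℝ E
  have hd1 : (1 : ℝ) ≤ d := by exact_mod_cast Module.finrank_pos
  have hlogζ : 0 ≤ Real.log ζ := Real.log_nonneg hζ1
  have hlog2 := Real.log_two_lt_d9
  have hlog2' : 0 < Real.log 2 := Real.log_pos one_lt_two
  obtain ⟨m, hm, hm'⟩ : ∃ m : ℕ, N (θ - θs) ≤ b * 2 ^ m ∧ (m = 0 ∨ b * 2 ^ m / 2 < N (θ - θs)) := by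
    have hex : ∃ m : ℕ, N (θ - θs) ≤ b * 2 ^ m := by
      obtain ⟨m, hm⟩ := pow_unbounded_of_one_lt (N (θ - θs) / b) one_lt_two
      exact ⟨m, by rw [div_lt_iff₀ hb] at hm; linarith⟩
    classical
    refine ⟨Nat.find hex, Nat.find_spec hex, ?_⟩
    rcases Nat.eq_zero_or_pos (Nat.find hex) with h | h
    · exact .inl h
    · right
      have h1 := Nat.find_min hex (Nat.sub_lt h one_pos)
      push Not at h1
      have h2 : (2 : ℝ) ^ Nat.find hex = 2 ^ (Nat.find hex - 1) * 2 := by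
        rw [← pow_succ, Nat.sub_add_cancel h]
      rw [h2]
      linarith
  refine sub_sq_half_le_of_dyadic hb (by positivity) ?_ hm'
  set R := min (b * 2 ^ m) r₀ with hR
  have hR0 : 0 < R := lt_min (by positivity) hr₀
  have hθR : θ ∈ N.closedBall θs R := by
    rw [Seminorm.mem_closedBall]; exact le_min hm hθ
  have hsR : θs ∈ N.closedBall θs R := by
    rw [Seminorm.mem_closedBall]; simpa using hR0.le
  have hdiam : ∀ s ∈ N.closedBall θs R, ∀ t ∈ N.closedBall θs R, N (s - t) ≤ 2 * R := by
    intro s hs t ht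
    rw [Seminorm.mem_closedBall] at hs ht
    rw [map_sub_rev] at ht
    have := map_add_le_add N (s - θs) (θs - t)
    rw [sub_add_sub_cancel] at this
    linarith
  -- a single scale exceeds the weighted average by at most the inverse of its weight
  have hone : expOsc N lam (vol[|N.closedBall θs R]) f ≤ ENNReal.ofReal (2 ^ (m + 1) * ζ) := by
    have h1 : (2⁻¹ : ENNReal) ^ (m + 1) * expOsc N lam (vol[|N.closedBall θs R]) f
        ≤ ENNReal.ofReal ζ := (ENNReal.le_tsum (f := fun m : ℕ => (2⁻¹ : ENNReal) ^ (m + 1) *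
          expOsc N lam (vol[|N.closedBall θs (min (b * 2 ^ m) r₀)]) f) m).trans hζ
    have h2 : (2 : ENNReal) ^ (m + 1) * (2⁻¹) ^ (m + 1) = 1 := by
      rw [← mul_pow, ENNReal.mul_inv_cancel (by norm_num) (by norm_num), one_pow]
    calc _ = (2 : ENNReal) ^ (m + 1) * ((2⁻¹) ^ (m + 1) *
            expOsc N lam (vol[|N.closedBall θs R]) f) := by rw [← mul_assoc, h2, one_mul]
      _ ≤ 2 ^ (m + 1) * ENNReal.ofReal ζ := by gcongr
      _ = _ := by
        rw [ENNReal.ofReal_mul (by positivity), ENNReal.ofReal_pow (by norm_num)]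
        simp
  have hch : ∀ η ∈ N.closedBall θs R, |f η - ∫ u, f u ∂vol[|N.closedBall θs R]|
      ≤ 2 * R / lam * (2 * Real.log (2 ^ (m + 1) * ζ) + 6 * d * Real.log 2) := fun η hη =>
    abs_sub_average_le (measurableSet_seminormClosedBall hN θs R) (N.convex_closedBall θs R)
      (addHaar_seminormClosedBall_ne_zero hN θs hR0)
      (addHaar_seminormClosedBall_ne_top hκ0 hκ θs R) hN.measurable hdiam hf hL hL0 hlam
      (one_le_mul_of_one_le_of_one_le (one_le_pow₀ one_le_two) hζ1) hone hη
  have h1 := hch θ hθR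
  have h2 := hch θs hsR
  rw [abs_sub_comm, hf0, sub_zero] at h2
  have h3 := abs_add_le (f θ - ∫ u, f u ∂vol[|N.closedBall θs R])
    (∫ u, f u ∂vol[|N.closedBall θs R])
  rw [sub_add_cancel] at h3
  rw [Real.log_mul (by positivity) (by positivity), Real.log_pow] at h1 h2
  have hm0 : (0 : ℝ) ≤ m := m.cast_nonneg
  have hRb : R ≤ b * 2 ^ m := min_le_left _ _
  calc |f θ| ≤ R / lam * (8 * Real.log ζ + 8 * (m + 1) * Real.log 2 + 24 * d * Real.log 2) := by
        refine h3.trans ((add_le_add h1 h2).trans (le_of_eq ?_))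
        push_cast
        ring
    _ ≤ b * 2 ^ m / lam * (23 * ((m + 1) * (Real.log ζ + d))) := by
        gcongr
        have e1 : 8 * ((m : ℝ) + 1) * Real.log 2 ≤ 5.6 * ((m + 1) * d) := by
          have : ((m : ℝ) + 1) * Real.log 2 ≤ ((m + 1) * d) * 0.7 := by
            have : (m : ℝ) + 1 ≤ (m + 1) * d := by nlinarith
            exact mul_le_mul this (by linarith) hlog2'.le (by positivity)
          linarith
        have e2 : 24 * d * Real.log 2 ≤ 16.8 * ((m + 1) * d) := by
          have : (d : ℝ) * Real.log 2 ≤ ((m + 1) * d) * 0.7 := by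
            have : (d : ℝ) ≤ (m + 1) * d := by nlinarith
            exact mul_le_mul this (by linarith) hlog2'.le (by positivity)
          linarith
        have e3 : Real.log ζ ≤ (m + 1) * Real.log ζ := by nlinarith
        have e4 : 0 ≤ ((m : ℝ) + 1) * d := by positivity
        have e5 : 0 ≤ ((m : ℝ) + 1) * Real.log ζ := by positivity
        linarith
    _ = _ := by ring

/-- A process with sub-Gaussian increments, minus the penalty `N(θ - θs)² / 2`, is bounded by the
logarithm of a random variable `Z ≥ 1` with a controlled mean, whatever the radius `r₀`.  The scale
`b` and the argument `lam` of the exponential moments are free. -/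
theorem exists_penalized_bound [Nontrivial E] {Ω : Type*} [MeasurableSpace Ω] {P : Measure Ω}
    [SFinite P] {N : Seminorm ℝ E} (hN : Continuous N) {κ : ℝ} (hκ0 : 0 ≤ κ)
    (hκ : ∀ γ, ‖γ‖ ≤ κ * N γ) {θs : E} {r₀ b lam : ℝ}
    (hr₀ : 0 < r₀) (hb : 0 < b) (hlam : 0 < lam) {U : E → Ω → ℝ}
    (hU : Measurable (Function.uncurry U)) (hU0 : ∀ ω, U θs ω = 0)
    {L : ℝ} (hL : ∀ s t ω, |U s ω - U t ω| ≤ L * N (s - t)) (hL0 : 0 ≤ L) {c : ℝ}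
    (h : ∀ s, N (s - θs) ≤ r₀ → ∀ t, N (t - θs) ≤ r₀ →
      ∫⁻ ω, ENNReal.ofReal (Real.exp (lam * (|U s ω - U t ω| / N (s - t)))) ∂P
        ≤ ENNReal.ofReal c) :
    ∃ Z : Ω → ENNReal, Measurable Z ∧ ∫⁻ ω, Z ω ∂P ≤ ENNReal.ofReal c ∧ (∀ ω, Z ω ≠ ⊤) ∧
      (∀ ω, 1 ≤ (Z ω).toReal) ∧ ∀ ω θ, N (θ - θs) ≤ r₀ → |U θ ω| - N (θ - θs) ^ 2 / 2 ≤
      b * (23 * (Real.log (Z ω).toReal + Module.finrank ℝ E) / lam)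
        + 2592 * (23 * (Real.log (Z ω).toReal + Module.finrank ℝ E) / lam) ^ 4 / b ^ 2 := by
  let vol : Measure E := Measure.addHaar
  have hprob : ∀ m : ℕ,
      IsProbabilityMeasure (vol[|N.closedBall θs (min (b * 2 ^ m) r₀)]) := fun m =>
    cond_isProbabilityMeasure_of_finite
      (addHaar_seminormClosedBall_ne_zero hN θs (lt_min (by positivity) hr₀))
      (addHaar_seminormClosedBall_ne_top hκ0 hκ θs _)
  have hfin : ∀ ω, multiscaleOsc N vol θs r₀ b lam (fun θ => U θ ω)
      ≤ ENNReal.ofReal (Real.exp (lam * L)) := fun ω => by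
    calc _ ≤ ∑' m : ℕ, (2⁻¹ : ENNReal) ^ (m + 1) * ENNReal.ofReal (Real.exp (lam * L)) := by
          refine ENNReal.tsum_le_tsum fun m => ?_
          gcongr
          exact expOsc_le_of_lipschitz hlam (fun s t => hL s t ω) hL0
      _ = _ := by rw [ENNReal.tsum_mul_right, tsum_two_inv_pow_succ, one_mul]
  have htop : ∀ ω, multiscaleOsc N vol θs r₀ b lam (fun θ => U θ ω) ≠ ⊤ := fun ω =>
    ne_top_of_le_ne_top ENNReal.ofReal_ne_top (hfin ω)
  have hge : ∀ ω, 1 ≤ multiscaleOsc N vol θs r₀ b lam (fun θ => U θ ω) := fun ω => by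
    rw [← tsum_two_inv_pow_succ]
    refine ENNReal.tsum_le_tsum fun m => ?_
    exact le_mul_of_one_le_right' (one_le_expOsc hlam)
  have hge' : ∀ ω, 1 ≤ (multiscaleOsc N vol θs r₀ b lam (fun θ => U θ ω)).toReal := fun ω => by
    rw [← ENNReal.toReal_one]
    exact ENNReal.toReal_mono (htop ω) (hge ω)
  have hmeas : ∀ m : ℕ, Measurable fun ω => (2⁻¹ : ENNReal) ^ (m + 1) *
      expOsc N lam (vol[|N.closedBall θs (min (b * 2 ^ m) r₀)]) (fun θ => U θ ω) := fun m =>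
    (measurable_expOsc hN.measurable hU).const_mul _
  refine ⟨fun ω => multiscaleOsc N vol θs r₀ b lam (fun θ => U θ ω), Measurable.tsum hmeas,
    ?_, htop, hge', fun ω θ hθ => ?_⟩
  · unfold multiscaleOsc
    rw [lintegral_tsum fun m => (hmeas m).aemeasurable]
    calc _ ≤ ∑' m : ℕ, (2⁻¹ : ENNReal) ^ (m + 1) * ENNReal.ofReal c := by
          refine ENNReal.tsum_le_tsum fun m => ?_
          rw [lintegral_const_mul _ (measurable_expOsc hN.measurable hU)]
          gcongr
          refine lintegral_expOsc_le hN.measurable hU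
            (ae_cond_mem (measurableSet_seminormClosedBall hN θs _)) fun s hs t ht => ?_
          rw [Seminorm.mem_closedBall] at hs ht
          exact h s (hs.trans (min_le_right _ _)) t (ht.trans (min_le_right _ _))
      _ = _ := by rw [ENNReal.tsum_mul_right, tsum_two_inv_pow_succ, one_mul]
  · exact abs_sub_sq_half_le_of_multiscaleOsc (vol := vol) hN hκ0 hκ hr₀ hb hlam
      (hU.comp measurable_prodMk_right) (hU0 ω) (fun s t => hL s t ω) hL0 (hge' ω)
      (ENNReal.ofReal_toReal (htop ω)).ge hθ

end Penalized

/-! ### Tail and moments of the supremum of a penalized process -/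

section Supremum

variable {E : Type*} [NormedAddCommGroup E] [NormedSpace ℝ E] [FiniteDimensional ℝ E]
  [MeasurableSpace E] [BorelSpace E] [Nontrivial E] {Ω : Type*} [MeasurableSpace Ω] {P : Measure Ω}
  [SFinite P] {N : Seminorm ℝ E} {κ : ℝ} {θs : E} {r₀ g ν : ℝ} {U : E → Ω → ℝ} {L : ℝ} {D : Ω → ℝ}

/-- The constant in front of `x + dim` in the deviation bound for a penalized process with
sub-Gaussian parameter `ν`. -/
noncomputable def tailConst (ν : ℝ) : ℝ :=
  23 * (ν ^ 2 / 2 + 2) + 2592 * (23 * (ν ^ 2 / 2 + 2)) ^ 4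

theorem one_le_tailConst (ν : ℝ) : 1 ≤ tailConst ν := by
  unfold tailConst
  have h1 : 0 ≤ 2592 * (23 * (ν ^ 2 / 2 + 2)) ^ 4 := by positivity
  nlinarith [sq_nonneg ν]

/-- Deviation bound in the sub-Gaussian zone `x + dim ≤ g²`. -/
theorem measure_tailConst_mul_lt_le (hN : Continuous N) (hκ0 : 0 ≤ κ) (hκ : ∀ γ, ‖γ‖ ≤ κ * N γ)
    (hr₀ : 0 < r₀) (hU : Measurable (Function.uncurry U)) (hU0 : ∀ ω, U θs ω = 0)
    (hL : ∀ s t ω, |U s ω - U t ω| ≤ L * N (s - t)) (hL0 : 0 ≤ L)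
    (h : ∀ lam, 0 < lam → lam ≤ g → ∀ s, N (s - θs) ≤ r₀ → ∀ t, N (t - θs) ≤ r₀ →
      ∫⁻ ω, ENNReal.ofReal (Real.exp (lam * (|U s ω - U t ω| / N (s - t)))) ∂P
        ≤ ENNReal.ofReal (2 * Real.exp (ν ^ 2 * lam ^ 2 / 2)))
    (hD : ∀ ω c, 0 ≤ c → (∀ θ, N (θ - θs) ≤ r₀ → |U θ ω| - N (θ - θs) ^ 2 / 2 ≤ c) → D ω ≤ c)
    {x : ℝ} (hx : 0 ≤ x) (hxg : √(x + Module.finrank ℝ E) ≤ g) :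
    P {ω | tailConst ν * (x + Module.finrank ℝ E) < D ω} ≤ ENNReal.ofReal (Real.exp (-x)) := by
  set d := Module.finrank ℝ E
  have hd1 : (1 : ℝ) ≤ d := by exact_mod_cast Module.finrank_pos
  set z := x + d with hz
  have hz1 : 1 ≤ z := by linarith
  have hz0 : 0 < z := by linarith
  have hsz : 0 < √z := Real.sqrt_pos.2 hz0
  have hsq : √z ^ 2 = z := Real.sq_sqrt hz0.le
  obtain ⟨Z, hZm, hZint, hZtop, hZ1, hZb⟩ := exists_penalized_bound (P := P) hN hκ0 hκ hr₀
    hsz hsz hU hU0 hL hL0 (h (√z) hsz hxg)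
  rw [hsq] at hZint
  -- `e ^ x` times the bound for the mean of `Z`
  set w : ℝ := 2 * Real.exp (ν ^ 2 * z / 2 + x) with hw
  have hw0 : 0 < w := by positivity
  have hsub : {ω | tailConst ν * z < D ω} ⊆ {ω | ENNReal.ofReal w ≤ Z ω} := by
    intro ω hω
    by_contra hcon
    simp only [Set.mem_ofPred_eq, not_le] at hω hcon
    refine absurd hω (not_lt.2 (hD ω _ (by have := one_le_tailConst ν; positivity) fun θ hθ => ?_))
    have hlt : (Z ω).toReal ≤ w := ENNReal.toReal_le_of_le_ofReal hw0.le hcon.le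
    have hlog : Real.log (Z ω).toReal ≤ ν ^ 2 * z / 2 + x + 1 := by
      refine (Real.log_le_log (by linarith [hZ1 ω]) hlt).trans ?_
      rw [hw, Real.log_mul two_ne_zero (Real.exp_pos _).ne', Real.log_exp]
      linarith [Real.log_two_lt_d9]
    have hlog0 : 0 ≤ Real.log (Z ω).toReal := Real.log_nonneg (hZ1 ω)
    refine (hZb ω θ hθ).trans ?_
    have hT : 23 * (Real.log (Z ω).toReal + d) / √z ≤ 23 * (ν ^ 2 / 2 + 2) * √z := by
      rw [div_le_iff₀ hsz, mul_assoc _ (√z), ← sq, hsq]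
      nlinarith
    have hT0 : 0 ≤ 23 * (Real.log (Z ω).toReal + d) / √z := by positivity
    calc _ ≤ √z * (23 * (ν ^ 2 / 2 + 2) * √z)
            + 2592 * (23 * (ν ^ 2 / 2 + 2) * √z) ^ 4 / √z ^ 2 := by gcongr
      _ = (23 * (ν ^ 2 / 2 + 2) + 2592 * (23 * (ν ^ 2 / 2 + 2)) ^ 4) * √z ^ 2 := by
          field_simp
      _ = tailConst ν * z := by rw [hsq, tailConst]
  calc P {ω | tailConst ν * z < D ω} ≤ P {ω | ENNReal.ofReal w ≤ Z ω} := measure_mono hsub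
    _ ≤ (∫⁻ ω, Z ω ∂P) / ENNReal.ofReal w :=
        meas_ge_le_lintegral_div hZm.aemeasurable (by simpa using hw0) ENNReal.ofReal_ne_top
    _ ≤ ENNReal.ofReal (2 * Real.exp (ν ^ 2 * z / 2)) / ENNReal.ofReal w := by gcongr
    _ = ENNReal.ofReal (Real.exp (-x)) := by
        rw [← ENNReal.ofReal_div_of_pos hw0, hw, mul_div_mul_left _ _ two_ne_zero, ← Real.exp_sub]
        congr 2
        ring

/-- The bound for the `r`-th moment of the supremum of a penalized process in dimension `d` with
exponential moments of order up to `g₀`. -/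
noncomputable def momentConst (ν : ℝ) (d : ℕ) (g₀ r : ℝ) : ℝ :=
  (2593 * (23 / min g₀ 1) ^ 4) ^ r * (4 * r + d) ^ (4 * r)
    * (2 * Real.exp (ν ^ 2 * min g₀ 1 ^ 2 / 2))

/-- Moment bound: a power of the logarithm of `Z` is dominated by `Z` itself. -/
theorem integral_rpow_le_momentConst (hN : Continuous N) (hκ0 : 0 ≤ κ)
    (hκ : ∀ γ, ‖γ‖ ≤ κ * N γ)
    (hr₀ : 0 < r₀) (hU : Measurable (Function.uncurry U)) (hU0 : ∀ ω, U θs ω = 0)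
    (hL : ∀ s t ω, |U s ω - U t ω| ≤ L * N (s - t)) (hL0 : 0 ≤ L)
    (h : ∀ lam, 0 < lam → lam ≤ g → ∀ s, N (s - θs) ≤ r₀ → ∀ t, N (t - θs) ≤ r₀ →
      ∫⁻ ω, ENNReal.ofReal (Real.exp (lam * (|U s ω - U t ω| / N (s - t)))) ∂P
        ≤ ENNReal.ofReal (2 * Real.exp (ν ^ 2 * lam ^ 2 / 2)))
    (hDm : Measurable D) (hD0 : ∀ ω, 0 ≤ D ω)
    (hD : ∀ ω c, 0 ≤ c → (∀ θ, N (θ - θs) ≤ r₀ → |U θ ω| - N (θ - θs) ^ 2 / 2 ≤ c) → D ω ≤ c)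
    {g₀ r : ℝ} (hg₀ : 0 < g₀) (hr : 0 < r) (hg : g₀ ≤ g) :
    Integrable (fun ω => |D ω| ^ r) P ∧
      ∫ ω, |D ω| ^ r ∂P ≤ momentConst ν (Module.finrank ℝ E) g₀ r := by
  set d := Module.finrank ℝ E
  have hd1 : (1 : ℝ) ≤ d := by exact_mod_cast Module.finrank_pos
  set lam := min g₀ 1 with hlamdef
  have hlam : 0 < lam := lt_min hg₀ one_pos
  have hlam1 : lam ≤ 1 := min_le_right _ _
  obtain ⟨Z, hZm, hZint, hZtop, hZ1, hZb⟩ := exists_penalized_bound (P := P) hN hκ0 hκ hr₀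
    one_pos hlam hU hU0 hL hL0 (h lam hlam ((min_le_left _ _).trans hg))
  have hpt : ∀ ω, |D ω| ^ r ≤ (2593 * (23 / lam) ^ 4) ^ r * (4 * r + d) ^ (4 * r)
      * (Z ω).toReal := by
    intro ω
    set ζ := (Z ω).toReal
    have hζ : 1 ≤ ζ := hZ1 ω
    have hζ0 : 0 < ζ := by linarith
    have hlog0 : 0 ≤ Real.log ζ := Real.log_nonneg hζ
    set Q := Real.log ζ + d with hQ
    have hQ1 : 1 ≤ Q := by linarith
    have hT1 : 1 ≤ 23 * Q / lam := by rw [one_le_div hlam]; linarith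
    have hDle : D ω ≤ 2593 * (23 / lam) ^ 4 * Q ^ 4 := by
      refine hD ω _ (by positivity) fun θ hθ => (hZb ω θ hθ).trans ?_
      have h1 : 23 * Q / lam ≤ (23 * Q / lam) ^ 4 := le_self_pow₀ hT1 (by norm_num)
      have h2 : (23 / lam) ^ 4 * Q ^ 4 = (23 * Q / lam) ^ 4 := by rw [← mul_pow]; congr 1; ring
      rw [mul_assoc, h2, one_mul, one_pow, div_one]
      linarith
    -- the exponent `1 / (4 r)` is chosen so that the power `4 r` of the bound is linear in `ζ`
    have hQle : Q ≤ (4 * r + d) * ζ ^ (1 / (4 * r)) := by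
      have h1 := Real.log_le_rpow_div hζ0.le (show 0 < 1 / (4 * r) by positivity)
      have h2 : 1 ≤ ζ ^ (1 / (4 * r)) := Real.one_le_rpow hζ (by positivity)
      have h3 : ζ ^ (1 / (4 * r)) / (1 / (4 * r)) = 4 * r * ζ ^ (1 / (4 * r)) := by
        field_simp
      rw [h3] at h1
      nlinarith
    have hQ0 : 0 ≤ Q := by linarith
    rw [abs_of_nonneg (hD0 ω)]
    calc D ω ^ r ≤ (2593 * (23 / lam) ^ 4 * Q ^ 4) ^ r :=
          Real.rpow_le_rpow (hD0 ω) hDle hr.le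
      _ = (2593 * (23 / lam) ^ 4) ^ r * Q ^ (4 * r) := by
          rw [Real.mul_rpow (by positivity) (by positivity), Real.rpow_mul hQ0]
          norm_cast
      _ ≤ (2593 * (23 / lam) ^ 4) ^ r * ((4 * r + d) * ζ ^ (1 / (4 * r))) ^ (4 * r) := by
          gcongr
      _ = (2593 * (23 / lam) ^ 4) ^ r * ((4 * r + d) ^ (4 * r) * ζ) := by
          rw [Real.mul_rpow (x := 4 * r + d) (by positivity) (by positivity), ← Real.rpow_mul hζ0.le,
            one_div, inv_mul_cancel₀ (by positivity), Real.rpow_one]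
      _ = _ := by ring
  have hZne : ∫⁻ ω, Z ω ∂P ≠ ⊤ := ne_top_of_le_ne_top ENNReal.ofReal_ne_top hZint
  have hZi : Integrable (fun ω => (Z ω).toReal) P :=
    integrable_toReal_of_lintegral_ne_top hZm.aemeasurable hZne
  have hi : Integrable (fun ω => |D ω| ^ r) P := by
    refine (hZi.const_mul ((2593 * (23 / lam) ^ 4) ^ r * (4 * r + d) ^ (4 * r))).mono'
      (Measurable.aestronglyMeasurable (by fun_prop)) (.of_forall fun ω => ?_)
    rw [Real.norm_eq_abs, abs_of_nonneg (by positivity)]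
    exact hpt ω
  refine ⟨hi, ?_⟩
  calc ∫ ω, |D ω| ^ r ∂P
      ≤ ∫ ω, (2593 * (23 / lam) ^ 4) ^ r * (4 * r + d) ^ (4 * r) * (Z ω).toReal ∂P :=
        integral_mono hi (hZi.const_mul _) hpt
    _ = (2593 * (23 / lam) ^ 4) ^ r * (4 * r + d) ^ (4 * r) * ∫ ω, (Z ω).toReal ∂P :=
        integral_const_mul _ _
    _ ≤ _ := by
        rw [momentConst]
        gcongr
        rw [integral_toReal hZm.aemeasurable (.of_forall fun ω => (hZtop ω).lt_top)]
        exact ENNReal.toReal_le_of_le_ofReal (by positivity) hZint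

end Supremum

/-! ### The check function -/

theorem checkFn_eq_max {τ : ℝ} (u : ℝ) : checkFn τ u = max (τ * u) ((τ - 1) * u) := by
  unfold checkFn
  split_ifs with h
  · rw [max_eq_right (by linarith)]; ring
  · rw [max_eq_left (by linarith)]; ring

@[fun_prop]
theorem continuous_checkFn (τ : ℝ) : Continuous (checkFn τ) := by
  have : checkFn τ = fun u => max (τ * u) ((τ - 1) * u) := funext checkFn_eq_max
  rw [this]
  fun_prop

theorem abs_checkFn_sub_le {τ : ℝ} (h0 : 0 < τ) (h1 : τ < 1) (a b : ℝ) :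
    |checkFn τ a - checkFn τ b| ≤ |a - b| := by
  rw [checkFn_eq_max, checkFn_eq_max]
  refine (abs_max_sub_max_le_max _ _ _ _).trans (max_le ?_ ?_)
  · rw [← mul_sub, abs_mul, abs_of_pos h0]
    nlinarith [abs_nonneg (a - b)]
  · rw [← mul_sub, abs_mul, abs_of_neg (by linarith)]
    nlinarith [abs_nonneg (a - b)]

/-- The fundamental theorem of calculus for the check function along a line, which has at most one
kink. -/
theorem checkFn_sub_eq_integral (τ u c : ℝ) :
    checkFn τ u - checkFn τ (u - c) =
      ∫ a in (0 : ℝ)..1, (τ - if u - a * c < 0 then 1 else 0) * c := by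
  by_cases hc : c = 0
  · simp [hc]
  have h := integral_eq_of_hasDerivAt_off_countable (fun a : ℝ => -checkFn τ (u - a * c))
    (fun a => (τ - if u - a * c < 0 then 1 else 0) * c) (a := 0) (b := 1) (s := {u / c})
    (Set.countable_singleton _) (by fun_prop) ?_ ?_
  · rw [h]; simp; ring
  · rintro a ⟨-, ha⟩
    have hne : u - a * c ≠ 0 := fun h0 => ha (by
      rw [Set.mem_singleton_iff, eq_div_iff hc]; linarith)
    have h1 : HasDerivAt (fun a : ℝ => u - a * c) (-c) a := by
      simpa using ((hasDerivAt_id a).mul_const c).const_sub u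
    have h2 := ((hasDerivAt_checkFn τ hne).comp a h1).fun_neg
    exact h2.congr_deriv (by ring)
  · rw [intervalIntegrable_iff_integrableOn_Ioc_of_le zero_le_one]
    have hm : Measurable fun a : ℝ => (τ - if u - a * c < 0 then (1 : ℝ) else 0) * c :=
      (measurable_const.sub (Measurable.ite (measurableSet_lt (by fun_prop) measurable_const)
        measurable_const measurable_const)).mul_const c
    refine Integrable.of_bound hm.aestronglyMeasurable ((|τ| + 1) * |c|) (.of_forall fun a => ?_)
    rw [Real.norm_eq_abs, abs_mul]
    gcongr
    refine (abs_sub _ _).trans ?_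
    gcongr
    split_ifs <;> simp

namespace QRModel

variable {p n K : ℕ} (M : QRModel p n K)

/-! ### The seminorm of the local quadratic form and the local sample size -/

theorem tau_mul_pos : 0 < M.τ * (1 - M.τ) :=
  mul_pos M.τ_pos (by linarith [M.τ_lt_one])

/-- The linear map `γ ↦ (√(τ(1-τ)) w_i Ψ_iᵀγ)_i`, whose Euclidean norm is `‖V_k γ‖`. -/
noncomputable def vMap (k : Fin K) : (Fin (p + 1) → ℝ) →ₗ[ℝ] EuclideanSpace ℝ (Fin n) where
  toFun γ := WithLp.toLp 2 fun i => √(M.τ * (1 - M.τ)) * M.w k i * (γ ⬝ᵥ M.Psi i)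
  map_add' s t := by ext i; simp [mul_add]
  map_smul' c s := by ext i; simp; ring

/-- The seminorm `γ ↦ ‖V_k γ‖`. -/
noncomputable def vSeminorm (k : Fin K) : Seminorm ℝ (Fin (p + 1) → ℝ) :=
  (normSeminorm ℝ (EuclideanSpace ℝ (Fin n))).comp (M.vMap k)

theorem dotProduct_V2_mulVec (k : Fin K) (γ : Fin (p + 1) → ℝ) :
    γ ⬝ᵥ (M.V2 k *ᵥ γ) = M.τ * (1 - M.τ) * ∑ i, M.w k i ^ 2 * (γ ⬝ᵥ M.Psi i) ^ 2 := by
  unfold V2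
  rw [smul_mulVec, dotProduct_smul, smul_eq_mul, sum_mulVec, dotProduct_sum]
  congr 1
  refine Finset.sum_congr rfl fun i _ => ?_
  rw [smul_mulVec, dotProduct_smul, vecMulVec_mulVec, dotProduct_smul, smul_eq_mul]
  simp [dotProduct_comm (M.Psi i) γ, sq]

theorem vSeminorm_apply (k : Fin K) (γ : Fin (p + 1) → ℝ) : M.vSeminorm k γ = M.Vnorm k γ := by
  change ‖M.vMap k γ‖ = _
  rw [EuclideanSpace.norm_eq, Vnorm, dotProduct_V2_mulVec]
  congr 1
  rw [Finset.mul_sum]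
  refine Finset.sum_congr rfl fun i _ => ?_
  simp only [vMap, LinearMap.coe_mk, AddHom.coe_mk, Real.norm_eq_abs, sq_abs, mul_pow,
    Real.sq_sqrt M.tau_mul_pos.le]
  ring

theorem continuous_vSeminorm (k : Fin K) : Continuous (M.vSeminorm k) :=
  continuous_norm.comp (M.vMap k).continuous_of_finiteDimensional

theorem Vnorm_nonneg (k : Fin K) (γ : Fin (p + 1) → ℝ) : 0 ≤ M.Vnorm k γ := Real.sqrt_nonneg _

theorem Vnorm_pos {k : Fin K} (h : (M.V2 k).PosDef) {γ : Fin (p + 1) → ℝ} (hγ : γ ≠ 0) :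
    0 < M.Vnorm k γ := Real.sqrt_pos.2 (by simpa using h.dotProduct_mulVec_pos hγ)

theorem exists_norm_le_vSeminorm {k : Fin K} (h : (M.V2 k).PosDef) :
    ∃ κ : ℝ, 0 ≤ κ ∧ ∀ γ, ‖γ‖ ≤ κ * M.vSeminorm k γ := by
  have hker : (M.vMap k).ker = ⊥ := by
    rw [LinearMap.ker_eq_bot']
    intro γ hγ
    by_contra hne
    have h1 := M.Vnorm_pos h hne
    rw [← vSeminorm_apply] at h1
    change 0 < ‖M.vMap k γ‖ at h1
    simp [hγ] at h1
  obtain ⟨κ, -, hκ⟩ := (M.vMap k).exists_antilipschitzWith hker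
  exact ⟨κ, κ.2, fun γ => ZeroHomClass.bound_of_antilipschitz (M.vMap k) hκ γ⟩

theorem weight_mul_abs_le (k : Fin K) (i : Fin n) (γ : Fin (p + 1) → ℝ) :
    √(M.τ * (1 - M.τ)) * M.w k i * |γ ⬝ᵥ M.Psi i| ≤ M.Vnorm k γ := by
  have h1 := PiLp.norm_apply_le (M.vMap k γ) i
  have h2 : ‖M.vMap k γ‖ = M.Vnorm k γ := M.vSeminorm_apply k γ
  rw [h2] at h1
  refine le_trans (le_of_eq ?_) h1
  simp only [vMap, LinearMap.coe_mk, AddHom.coe_mk, Real.norm_eq_abs, abs_mul,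
    abs_of_nonneg (M.w_nonneg k i), abs_of_nonneg (Real.sqrt_nonneg _)]

/-- The local sample size is positive: the suprema in its definition are finite, since
`√(τ(1-τ)) w_i |γᵀΨ_i| ≤ ‖V_k γ‖`, and do not vanish, since `V_k²` does not. -/
theorem N_pos {k : Fin K} (h : (M.V2 k).PosDef) : 0 < M.N k := by
  set F : Fin n → (Fin (p + 1) → ℝ) → ℝ := fun i γ =>
    |γ ⬝ᵥ M.Psi i| * (if 0 < M.w k i then 1 else 0) / M.Vnorm k γ * √(M.τ * (1 - M.τ)) with hF
  have hτ : 0 < √(M.τ * (1 - M.τ)) := Real.sqrt_pos.2 M.tau_mul_pos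
  have hbdd : ∀ i γ, F i γ ≤ (M.w k i)⁻¹ := by
    intro i γ
    simp only [hF]
    have hw := M.w_nonneg k i
    split_ifs with hwi
    · rw [mul_one, div_mul_eq_mul_div]
      refine div_le_of_le_mul₀ (M.Vnorm_nonneg k γ) (inv_nonneg.2 hw) ?_
      rw [inv_mul_eq_div, le_div_iff₀ hwi]
      have := M.weight_mul_abs_le k i γ
      linarith
    · simpa using hw
  have hF0 : ∀ i γ, 0 ≤ F i γ := fun i γ => by
    have := M.Vnorm_nonneg k γ
    simp only [hF]
    positivity
  set e : Fin (p + 1) → ℝ := fun _ => 1 with he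
  have he0 : e ≠ 0 := fun h0 => by simpa [he] using congrFun h0 0
  obtain ⟨i, hi⟩ : ∃ i, M.w k i ^ 2 * (e ⬝ᵥ M.Psi i) ^ 2 ≠ 0 := by
    by_contra hcon
    push Not at hcon
    have h1 := M.Vnorm_pos h he0
    rw [Vnorm, dotProduct_V2_mulVec, Finset.sum_eq_zero fun i _ => hcon i] at h1
    simp at h1
  have hwi : 0 < M.w k i := (M.w_nonneg k i).lt_of_ne' fun h0 => hi (by simp [h0])
  have hei : 0 < |e ⬝ᵥ M.Psi i| := abs_pos.2 fun h0 => hi (by simp [h0])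
  have hpos : 0 < F i e := by
    have := M.Vnorm_pos h he0
    simp only [hF, if_pos hwi]
    positivity
  have h1 : F i e ≤ ⨆ γ, F i γ := le_ciSup ⟨_, Set.forall_mem_range.2 (hbdd i)⟩ e
  have h2 : ⨆ γ, F i γ ≤ ⨆ i, ⨆ γ, F i γ :=
    le_ciSup (f := fun i => ⨆ γ, F i γ) (Set.finite_range _).bddAbove i
  have h3 : 0 < ⨆ i, ⨆ γ, F i γ := hpos.trans_le (h1.trans h2)
  exact inv_pos.2 (pow_pos h3 2)

/-! ### Score and excess as integrable random variables -/

theorem abs_tau_sub_ite_le (q : Prop) [Decidable q] : |M.τ - if q then 1 else 0| ≤ 1 := by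
  have h0 := M.τ_pos
  have h1 := M.τ_lt_one
  split_ifs <;> rw [abs_le] <;> constructor <;> linarith

theorem dotProduct_score (k : Fin K) (γ θ : Fin (p + 1) → ℝ) (y : Fin n → ℝ) :
    γ ⬝ᵥ M.score k θ y =
      ∑ i, (M.τ - if y i - M.Psi i ⬝ᵥ θ < 0 then 1 else 0) * M.w k i * (γ ⬝ᵥ M.Psi i) := by
  simp only [score, dotProduct_sum, dotProduct_smul, smul_eq_mul]

/-- A Lipschitz constant of the excess with respect to `‖V_k ·‖`. -/
noncomputable def lipConst : ℝ := n / √(M.τ * (1 - M.τ))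

theorem lipConst_nonneg : 0 ≤ M.lipConst := by unfold lipConst; positivity

theorem sum_weight_mul_abs_le (k : Fin K) (γ : Fin (p + 1) → ℝ) :
    ∑ i, M.w k i * |γ ⬝ᵥ M.Psi i| ≤ M.lipConst * M.Vnorm k γ := by
  have hτ : 0 < √(M.τ * (1 - M.τ)) := Real.sqrt_pos.2 M.tau_mul_pos
  calc ∑ i, M.w k i * |γ ⬝ᵥ M.Psi i| ≤ ∑ _i : Fin n, M.Vnorm k γ / √(M.τ * (1 - M.τ)) := by
        refine Finset.sum_le_sum fun i _ => ?_
        rw [le_div_iff₀ hτ]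
        have := M.weight_mul_abs_le k i γ
        linarith
    _ = M.lipConst * M.Vnorm k γ := by
        rw [Finset.sum_const, Finset.card_univ, Fintype.card_fin, nsmul_eq_mul, lipConst]
        ring

theorem abs_dotProduct_score_le (k : Fin K) (γ θ : Fin (p + 1) → ℝ) (y : Fin n → ℝ) :
    |γ ⬝ᵥ M.score k θ y| ≤ M.lipConst * M.Vnorm k γ := by
  rw [dotProduct_score]
  refine (Finset.abs_sum_le_sum_abs _ _).trans ((Finset.sum_le_sum fun i _ => ?_).trans
    (M.sum_weight_mul_abs_le k γ))
  rw [abs_mul, abs_mul, abs_of_nonneg (M.w_nonneg k i)]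
  have h1 := M.abs_tau_sub_ite_le (y i - M.Psi i ⬝ᵥ θ < 0)
  have h2 : 0 ≤ M.w k i * |γ ⬝ᵥ M.Psi i| := mul_nonneg (M.w_nonneg k i) (abs_nonneg _)
  nlinarith

theorem excess_sub_excess (k : Fin K) (s t : Fin (p + 1) → ℝ) (y : Fin n → ℝ) :
    M.excess k s y - M.excess k t y =
      ∑ i, (checkFn M.τ (y i - M.Psi i ⬝ᵥ t) - checkFn M.τ (y i - M.Psi i ⬝ᵥ s)) * M.w k i := by
  simp only [excess, L, sub_mul, Finset.sum_sub_distrib]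
  ring

theorem abs_excess_sub_excess_le (k : Fin K) (s t : Fin (p + 1) → ℝ) (y : Fin n → ℝ) :
    |M.excess k s y - M.excess k t y| ≤ M.lipConst * M.Vnorm k (s - t) := by
  rw [excess_sub_excess]
  refine (Finset.abs_sum_le_sum_abs _ _).trans ((Finset.sum_le_sum fun i _ => ?_).trans
    (M.sum_weight_mul_abs_le k (s - t)))
  rw [abs_mul, abs_of_nonneg (M.w_nonneg k i), mul_comm]
  refine mul_le_mul_of_nonneg_left ((abs_checkFn_sub_le M.τ_pos M.τ_lt_one _ _).trans
    (le_of_eq ?_)) (M.w_nonneg k i)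
  rw [sub_dotProduct, dotProduct_comm s, dotProduct_comm t]
  congr 1
  ring

@[simp]
theorem excess_self (k : Fin K) (y : Fin n → ℝ) : M.excess k M.θs y = 0 := sub_self _

theorem abs_excess_le (k : Fin K) (θ : Fin (p + 1) → ℝ) (y : Fin n → ℝ) :
    |M.excess k θ y| ≤ M.lipConst * M.Vnorm k (θ - M.θs) := by
  simpa using M.abs_excess_sub_excess_le k θ M.θs y

theorem measurable_excess (k : Fin K) : Measurable (Function.uncurry (M.excess k)) := by
  have : Continuous (Function.uncurry (M.excess k)) := by
    unfold Function.uncurry excess L dotProduct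
    fun_prop
  exact this.measurable

theorem integrable_excess (k : Fin K) (θ : Fin (p + 1) → ℝ) :
    Integrable (M.excess k θ) M.P :=
  Integrable.of_bound ((M.measurable_excess k).comp measurable_prodMk_left).aestronglyMeasurable _
    (.of_forall fun y => M.abs_excess_le k θ y)

theorem measurable_score (k : Fin K) : Measurable (Function.uncurry (M.score k)) := by
  unfold Function.uncurry score
  refine Finset.measurable_sum _ fun i _ => ?_
  refine Measurable.smul_const (Measurable.mul_const (measurable_const.sub ?_) _) _
  refine Measurable.ite (measurableSet_lt ?_ measurable_const) measurable_const measurable_const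
  unfold dotProduct
  fun_prop

theorem measurable_dotProduct_left {α : Type*} [MeasurableSpace α] (γ : Fin (p + 1) → ℝ)
    {f : α → Fin (p + 1) → ℝ} (hf : Measurable f) : Measurable fun a => γ ⬝ᵥ f a := by
  unfold dotProduct
  fun_prop

theorem integrable_dotProduct_score (k : Fin K) (γ θ : Fin (p + 1) → ℝ) :
    Integrable (fun y => γ ⬝ᵥ M.score k θ y) M.P :=
  Integrable.of_bound (measurable_dotProduct_left γ
    ((M.measurable_score k).comp measurable_prodMk_left)).aestronglyMeasurable _
    (.of_forall fun y => M.abs_dotProduct_score_le k γ θ y)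

theorem dotProduct_integral_score (k : Fin K) (γ θ : Fin (p + 1) → ℝ) :
    γ ⬝ᵥ ∫ y, M.score k θ y ∂M.P = ∫ y, γ ⬝ᵥ M.score k θ y ∂M.P := by
  have hi : ∀ m, Integrable (fun y => M.score k θ y m) M.P := fun m => by
    simpa using M.integrable_dotProduct_score k (Pi.single m 1) θ
  unfold dotProduct
  rw [integral_finsetSum _ fun m _ => (hi m).const_mul _]
  refine Finset.sum_congr rfl fun m _ => ?_
  rw [eval_integral hi, integral_const_mul]

theorem dotProduct_gradZeta (k : Fin K) (γ θ : Fin (p + 1) → ℝ) (y : Fin n → ℝ) :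
    γ ⬝ᵥ M.gradZeta k θ y = γ ⬝ᵥ M.score k θ y - ∫ z, γ ⬝ᵥ M.score k θ z ∂M.P := by
  rw [gradZeta, dotProduct_sub, dotProduct_integral_score]

/-- The true parameter is a stationary point of the expected log-likelihood, because the residuals
have `τ`-quantile zero. -/
theorem integral_dotProduct_score_true (k : Fin K) (γ : Fin (p + 1) → ℝ) :
    ∫ y, γ ⬝ᵥ M.score k M.θs y ∂M.P = 0 := by
  have hprob : ∀ i, IsProbabilityMeasure
      ((M.residLaw i).map fun u => M.Psi i ⬝ᵥ M.θs + u) := fun i =>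
    Measure.isProbabilityMeasure_map (by fun_prop)
  have hset : ∀ i, MeasurableSet {y : Fin n → ℝ | y i - M.Psi i ⬝ᵥ M.θs < 0} := fun i =>
    measurableSet_lt (by fun_prop) measurable_const
  have hite : ∀ i, (fun y : Fin n → ℝ => if y i - M.Psi i ⬝ᵥ M.θs < 0 then (1 : ℝ) else 0) =
      {y : Fin n → ℝ | y i - M.Psi i ⬝ᵥ M.θs < 0}.indicator fun _ => (1 : ℝ) := fun i => by
    ext y; simp [Set.indicator_apply]
  have hval : ∀ i, ∫ y, (if y i - M.Psi i ⬝ᵥ M.θs < 0 then (1 : ℝ) else 0) ∂M.P = M.τ := by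
    intro i
    rw [hite i, integral_indicator_const _ (hset i), smul_eq_mul, mul_one, Measure.real]
    have h1 : {y : Fin n → ℝ | y i - M.Psi i ⬝ᵥ M.θs < 0} =
        Function.eval i ⁻¹' {v : ℝ | v - M.Psi i ⬝ᵥ M.θs < 0} := rfl
    have hs : MeasurableSet {v : ℝ | v - M.Psi i ⬝ᵥ M.θs < 0} :=
      measurableSet_lt (by fun_prop) measurable_const
    rw [h1, P, (measurePreserving_eval _ i).measure_preimage hs.nullMeasurableSet,
      Measure.map_apply (by fun_prop) hs]
    have h2 : (fun u => M.Psi i ⬝ᵥ M.θs + u) ⁻¹' {v : ℝ | v - M.Psi i ⬝ᵥ M.θs < 0}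
        = Set.Iio 0 := by ext u; simp
    rw [h2, residLaw, M.quantile i, ENNReal.toReal_ofReal M.τ_pos.le]
  have hii : ∀ i, Integrable (fun y : Fin n → ℝ =>
      if y i - M.Psi i ⬝ᵥ M.θs < 0 then (1 : ℝ) else 0) M.P := fun i => by
    rw [hite i]; exact (integrable_const _).indicator (hset i)
  simp only [dotProduct_score]
  have hti : ∀ i, Integrable (fun y : Fin n → ℝ => (M.τ - if y i - M.Psi i ⬝ᵥ M.θs < 0 then 1 else 0)
      * M.w k i * (γ ⬝ᵥ M.Psi i)) M.P := fun i =>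
    (((integrable_const M.τ).sub (hii i)).mul_const _).mul_const _
  rw [integral_finsetSum _ fun i _ => hti i]
  refine Finset.sum_eq_zero fun i _ => ?_
  rw [integral_mul_const, integral_mul_const, integral_sub (integrable_const _) (hii i), hval i]
  simp

/-- The excess is the line integral of the score. -/
theorem excess_sub_excess_eq_integral (k : Fin K) (s t : Fin (p + 1) → ℝ) (y : Fin n → ℝ) :
    M.excess k s y - M.excess k t y =
      ∫ a in (0 : ℝ)..1, (s - t) ⬝ᵥ M.score k (t + a • (s - t)) y := by
  have hterm : ∀ i, ∀ a : ℝ, y i - M.Psi i ⬝ᵥ (t + a • (s - t)) =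
      (y i - M.Psi i ⬝ᵥ t) - a * ((s - t) ⬝ᵥ M.Psi i) := fun i a => by
    rw [dotProduct_add, dotProduct_smul, smul_eq_mul, dotProduct_comm (M.Psi i) (s - t)]; ring
  have hs : ∀ i, y i - M.Psi i ⬝ᵥ s = (y i - M.Psi i ⬝ᵥ t) - (s - t) ⬝ᵥ M.Psi i := fun i => by
    rw [sub_dotProduct, dotProduct_comm s, dotProduct_comm t]; ring
  rw [excess_sub_excess]
  simp only [dotProduct_score]
  rw [intervalIntegral.integral_finsetSum]
  · refine Finset.sum_congr rfl fun i _ => ?_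
    rw [hs i, checkFn_sub_eq_integral, ← intervalIntegral.integral_mul_const]
    refine intervalIntegral.integral_congr fun a _ => ?_
    simp only [hterm]
    ring
  · intro i _
    rw [intervalIntegrable_iff_integrableOn_Ioc_of_le zero_le_one]
    refine Integrable.of_bound (Measurable.aestronglyMeasurable ?_)
      (1 * |M.w k i| * |(s - t) ⬝ᵥ M.Psi i|) (.of_forall fun a => ?_)
    · refine Measurable.mul_const (Measurable.mul_const (measurable_const.sub ?_) _) _
      refine Measurable.ite (measurableSet_lt ?_ measurable_const) measurable_const measurable_const
      simp only [hterm]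
      fun_prop
    · rw [Real.norm_eq_abs, abs_mul, abs_mul]
      gcongr
      exact M.abs_tau_sub_ite_le _

end QRModel

/-! ### The stochastic linearization error -/

/-- Jensen's inequality: exponential moments pass from a bounded process to its time average. -/
theorem lintegral_exp_setIntegral_le {Ω : Type*} [MeasurableSpace Ω] {P : Measure Ω}
    [IsProbabilityMeasure P] {X : ℝ → Ω → ℝ} (hXm : Measurable (Function.uncurry X)) {c : ℝ}
    (hc : ∀ a y, |X a y| ≤ c) {b : ℝ}
    (h : ∀ a ∈ Set.Ioc (0 : ℝ) 1, Real.log (∫ y, Real.exp (X a y) ∂P) ≤ b) :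
    ∫⁻ y, ENNReal.ofReal (Real.exp (∫ a in Set.Ioc (0 : ℝ) 1, X a y)) ∂P
      ≤ ENNReal.ofReal (Real.exp b) := by
  have hexpc : ∀ a y, ‖Real.exp (X a y)‖ ≤ Real.exp c := fun a y => by
    rw [Real.norm_eq_abs, abs_of_pos (Real.exp_pos _)]
    exact Real.exp_le_exp.2 ((le_abs_self _).trans (hc a y))
  have hXy : ∀ y, Measurable fun a => X a y := fun y => hXm.comp measurable_prodMk_right
  have hXa : ∀ a, Measurable (X a) := fun a => hXm.comp measurable_prodMk_left
  have hprob : IsProbabilityMeasure (volume.restrict (Set.Ioc (0 : ℝ) 1)) := ⟨by simp⟩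
  have hjensen : ∀ y, ENNReal.ofReal (Real.exp (∫ a in Set.Ioc (0 : ℝ) 1, X a y))
      ≤ ∫⁻ a in Set.Ioc (0 : ℝ) 1, ENNReal.ofReal (Real.exp (X a y)) := by
    intro y
    have hie : Integrable (fun a => Real.exp (X a y)) (volume.restrict (Set.Ioc (0 : ℝ) 1)) :=
      Integrable.of_bound (hXy y).exp.aestronglyMeasurable _ (.of_forall fun a => hexpc a y)
    rw [← ofReal_integral_eq_lintegral_ofReal hie (.of_forall fun a => (Real.exp_pos _).le)]
    refine ENNReal.ofReal_le_ofReal ?_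
    exact convexOn_exp.map_integral_le Real.continuous_exp.continuousOn isClosed_univ
      (.of_forall fun _ => Set.mem_univ _)
      (Integrable.of_bound (hXy y).aestronglyMeasurable c (.of_forall fun a => hc a y)) hie
  calc _ ≤ ∫⁻ y, (∫⁻ a in Set.Ioc (0 : ℝ) 1, ENNReal.ofReal (Real.exp (X a y))) ∂P :=
        lintegral_mono hjensen
    _ = ∫⁻ a in Set.Ioc (0 : ℝ) 1, ∫⁻ y, ENNReal.ofReal (Real.exp (X a y)) ∂P := by
        refine lintegral_lintegral_swap (Measurable.aemeasurable ?_)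
        exact (Real.measurable_exp.comp (hXm.comp measurable_swap)).ennreal_ofReal
    _ ≤ ∫⁻ _ in Set.Ioc (0 : ℝ) 1, ENNReal.ofReal (Real.exp b) := by
        refine setLIntegral_mono measurable_const fun a ha => ?_
        have hi : Integrable (fun y => Real.exp (X a y)) P :=
          Integrable.of_bound (hXa a).exp.aestronglyMeasurable _ (.of_forall fun y => hexpc a y)
        rw [← ofReal_integral_eq_lintegral_ofReal hi (.of_forall fun y => (Real.exp_pos _).le)]
        exact ENNReal.ofReal_le_ofReal ((Real.log_le_iff_le_exp (integral_exp_pos hi)).1 (h a ha))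
    _ = _ := by simp

namespace QRModel

variable {p n K : ℕ} (M : QRModel p n K)

theorem measurable_dotProduct_score_comp {α : Type*} [MeasurableSpace α] (k : Fin K)
    {γ θ : α → Fin (p + 1) → ℝ} {y : α → Fin n → ℝ} (hγ : Measurable γ) (hθ : Measurable θ)
    (hy : Measurable y) : Measurable fun a => γ a ⬝ᵥ M.score k (θ a) (y a) := by
  have h : Measurable fun a => Function.uncurry (M.score k) (θ a, y a) :=
    (M.measurable_score k).comp (hθ.prodMk hy)
  exact Finset.measurable_sum _ fun m _ =>
    ((measurable_pi_apply m).comp hγ).mul ((measurable_pi_apply m).comp h)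

/-- The remainder `ζ_k(θ) - ζ_k(θ*) - (θ - θ*)ᵀ ∇ζ_k(θ*)` of the centered log-likelihood. -/
noncomputable def linErr (k : Fin K) (θ : Fin (p + 1) → ℝ) (y : Fin n → ℝ) : ℝ :=
  M.excess k θ y - ∫ z, M.excess k θ z ∂M.P - (θ - M.θs) ⬝ᵥ M.score k M.θs y

@[simp]
theorem linErr_self (k : Fin K) (y : Fin n → ℝ) : M.linErr k M.θs y = 0 := by
  simp [linErr]

theorem measurable_linErr (k : Fin K) : Measurable (Function.uncurry (M.linErr k)) := by
  have h1 : Measurable fun θ => ∫ z, M.excess k θ z ∂M.P :=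
    (M.measurable_excess k).stronglyMeasurable.integral_prod_right'.measurable
  have h2 : Measurable fun q : (Fin (p + 1) → ℝ) × (Fin n → ℝ) =>
      (q.1 - M.θs) ⬝ᵥ M.score k M.θs q.2 :=
    M.measurable_dotProduct_score_comp k (by fun_prop) measurable_const measurable_snd
  exact ((M.measurable_excess k).sub (h1.comp measurable_fst)).sub h2

theorem linErr_sub_linErr (k : Fin K) (s t : Fin (p + 1) → ℝ) (y : Fin n → ℝ) :
    M.linErr k s y - M.linErr k t y = (M.excess k s y - M.excess k t y)
      - ∫ z, (M.excess k s z - M.excess k t z) ∂M.P - (s - t) ⬝ᵥ M.score k M.θs y := by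
  rw [integral_sub (M.integrable_excess k s) (M.integrable_excess k t)]
  simp only [linErr, sub_dotProduct]
  ring

theorem abs_linErr_sub_linErr_le (k : Fin K) (s t : Fin (p + 1) → ℝ) (y : Fin n → ℝ) :
    |M.linErr k s y - M.linErr k t y| ≤ 3 * M.lipConst * M.Vnorm k (s - t) := by
  rw [linErr_sub_linErr]
  have h1 := M.abs_excess_sub_excess_le k s t y
  have h2 := M.abs_dotProduct_score_le k (s - t) M.θs y
  have h3 : |∫ z, (M.excess k s z - M.excess k t z) ∂M.P|
      ≤ M.lipConst * M.Vnorm k (s - t) := by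
    rw [← Real.norm_eq_abs]
    refine (norm_integral_le_of_norm_le_const
      (.of_forall fun z => M.abs_excess_sub_excess_le k s t z)).trans (by simp)
  refine (abs_sub _ _).trans ?_
  have h4 := abs_sub (M.excess k s y - M.excess k t y)
    (∫ z, (M.excess k s z - M.excess k t z) ∂M.P)
  linarith

/-- The increments of the remainder are line integrals of `∇ζ_k(θ) - ∇ζ_k(θ*)`. -/
theorem linErr_sub_linErr_eq_integral (k : Fin K) (s t : Fin (p + 1) → ℝ) (y : Fin n → ℝ) :
    M.linErr k s y - M.linErr k t y = ∫ a in Set.Ioc (0 : ℝ) 1,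
      (s - t) ⬝ᵥ (M.gradZeta k (t + a • (s - t)) y - M.gradZeta k M.θs y) := by
  have hm : Measurable fun q : ℝ × (Fin n → ℝ) =>
      (s - t) ⬝ᵥ M.score k (t + q.1 • (s - t)) q.2 :=
    M.measurable_dotProduct_score_comp k measurable_const (by fun_prop) measurable_snd
  have hi : Integrable (fun q : ℝ × (Fin n → ℝ) =>
      (s - t) ⬝ᵥ M.score k (t + q.1 • (s - t)) q.2)
      ((volume.restrict (Set.Ioc (0 : ℝ) 1)).prod M.P) :=
    Integrable.of_bound hm.aestronglyMeasurable _
      (.of_forall fun q => M.abs_dotProduct_score_le k (s - t) _ q.2)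
  have hi1 : Integrable (fun a : ℝ => (s - t) ⬝ᵥ M.score k (t + a • (s - t)) y)
      (volume.restrict (Set.Ioc (0 : ℝ) 1)) :=
    Integrable.of_bound (hm.comp measurable_prodMk_right).aestronglyMeasurable _
      (.of_forall fun a => M.abs_dotProduct_score_le k (s - t) _ y)
  have hi2 : Integrable (fun a : ℝ => ∫ z, (s - t) ⬝ᵥ M.score k (t + a • (s - t)) z ∂M.P)
      (volume.restrict (Set.Ioc (0 : ℝ) 1)) := hi.integral_prod_left
  have hE : ∫ z, (M.excess k s z - M.excess k t z) ∂M.P =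
      ∫ a in Set.Ioc (0 : ℝ) 1, ∫ z, (s - t) ⬝ᵥ M.score k (t + a • (s - t)) z ∂M.P := by
    simp only [excess_sub_excess_eq_integral, intervalIntegral.integral_of_le zero_le_one]
    rw [integral_integral_swap]
    exact hi.swap
  rw [linErr_sub_linErr, hE, excess_sub_excess_eq_integral,
    intervalIntegral.integral_of_le zero_le_one]
  simp only [dotProduct_sub, dotProduct_gradZeta, integral_dotProduct_score_true, sub_zero]
  have hi12 : Integrable (fun a : ℝ => (s - t) ⬝ᵥ M.score k (t + a • (s - t)) y
      - ∫ z, (s - t) ⬝ᵥ M.score k (t + a • (s - t)) z ∂M.P)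
      (volume.restrict (Set.Ioc (0 : ℝ) 1)) := hi1.sub hi2
  rw [integral_sub hi12 (integrable_const _), integral_sub hi1 hi2]
  simp

theorem measurable_dotProduct_gradZeta_sub (k : Fin K) (γ t : Fin (p + 1) → ℝ) :
    Measurable fun q : ℝ × (Fin n → ℝ) =>
      γ ⬝ᵥ (M.gradZeta k (t + q.1 • γ) q.2 - M.gradZeta k M.θs q.2) := by
  have h1 : Measurable fun q : ℝ × (Fin n → ℝ) => γ ⬝ᵥ M.score k (t + q.1 • γ) q.2 :=
    M.measurable_dotProduct_score_comp k measurable_const (by fun_prop) measurable_snd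
  have h2 : Measurable fun a : ℝ => ∫ z, γ ⬝ᵥ M.score k (t + a • γ) z ∂M.P :=
    h1.stronglyMeasurable.integral_prod_right'.measurable
  have h2' : Measurable fun q : ℝ × (Fin n → ℝ) => ∫ z, γ ⬝ᵥ M.score k (t + q.1 • γ) z ∂M.P :=
    h2.comp measurable_fst
  have h3 : Measurable fun q : ℝ × (Fin n → ℝ) => γ ⬝ᵥ M.score k M.θs q.2 :=
    M.measurable_dotProduct_score_comp k measurable_const measurable_const measurable_snd
  simp only [dotProduct_sub, dotProduct_gradZeta, integral_dotProduct_score_true, sub_zero]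
  exact (h1.sub h2').sub h3

theorem abs_dotProduct_gradZeta_sub_le (k : Fin K) (γ θ : Fin (p + 1) → ℝ) (y : Fin n → ℝ) :
    |γ ⬝ᵥ (M.gradZeta k θ y - M.gradZeta k M.θs y)| ≤ 3 * (M.lipConst * M.Vnorm k γ) := by
  simp only [dotProduct_sub, dotProduct_gradZeta, integral_dotProduct_score_true, sub_zero]
  have h1 := M.abs_dotProduct_score_le k γ θ y
  have h2 := M.abs_dotProduct_score_le k γ M.θs y
  have h3 : |∫ z, γ ⬝ᵥ M.score k θ z ∂M.P| ≤ M.lipConst * M.Vnorm k γ := by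
    rw [← Real.norm_eq_abs]
    refine (norm_integral_le_of_norm_le_const
      (.of_forall fun z => M.abs_dotProduct_score_le k γ _ z)).trans (by simp)
  have h4 := abs_sub (γ ⬝ᵥ M.score k θ y - ∫ z, γ ⬝ᵥ M.score k θ z ∂M.P)
    (γ ⬝ᵥ M.score k M.θs y)
  have h5 := abs_sub (γ ⬝ᵥ M.score k θ y) (∫ z, γ ⬝ᵥ M.score k θ z ∂M.P)
  linarith

theorem segment_mem_Θloc {k : Fin K} {r : ℝ} {s t : Fin (p + 1) → ℝ}
    (hs : M.vSeminorm k (s - M.θs) ≤ r) (ht : M.vSeminorm k (t - M.θs) ≤ r) {a : ℝ}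
    (ha : a ∈ Set.Ioc (0 : ℝ) 1) : t + a • (s - t) ∈ M.Θloc k r := by
  change M.Vnorm k _ ≤ r
  rw [← vSeminorm_apply]
  have : t + a • (s - t) - M.θs = (1 - a) • (t - M.θs) + a • (s - M.θs) := by module
  rw [this]
  refine (map_add_le_add _ _ _).trans ?_
  rw [map_smul_eq_mul, map_smul_eq_mul, Real.norm_eq_abs, Real.norm_eq_abs,
    abs_of_nonneg (sub_nonneg.2 ha.2), abs_of_pos ha.1]
  nlinarith [ha.1, ha.2]

/-- The exponential moments of the score increments pass to the increments of the remainder. -/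
theorem lintegral_exp_linErr_le {k : Fin K} {r₀ g ν ϱ : ℝ} {ϱf : ℝ → ℝ}
    (h : M.CondED1 k r₀ g ν ϱf) (hr₀ : 0 < r₀) (hϱ : ϱf r₀ ≤ ϱ) {lam : ℝ} (hlam : |lam| ≤ g)
    {s t : Fin (p + 1) → ℝ} (hs : M.vSeminorm k (s - M.θs) ≤ r₀)
    (ht : M.vSeminorm k (t - M.θs) ≤ r₀) :
    ∫⁻ y, ENNReal.ofReal (Real.exp
      (lam * ((M.linErr k s y - M.linErr k t y) / (ϱ * M.Vnorm k (s - t))))) ∂M.P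
      ≤ ENNReal.ofReal (Real.exp (ν ^ 2 * lam ^ 2 / 2)) := by
  obtain ⟨hϱ0, -, hED⟩ := h r₀ hr₀ le_rfl
  have hϱpos : 0 < ϱ := hϱ0.trans_le hϱ
  -- a larger `ϱ` amounts to a smaller argument of the exponential moments
  obtain ⟨lam', hlam', habs⟩ : ∃ lam' : ℝ, lam' = lam * (ϱf r₀ / ϱ) ∧ |lam'| ≤ |lam| := by
    have hratio : 0 ≤ ϱf r₀ / ϱ := by positivity
    refine ⟨_, rfl, ?_⟩
    rw [abs_mul, abs_of_nonneg hratio]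
    exact mul_le_of_le_one_right (abs_nonneg _) ((div_le_one hϱpos).2 hϱ)
  have hconv : ∀ y, lam * ((M.linErr k s y - M.linErr k t y) / (ϱ * M.Vnorm k (s - t))) =
      ∫ a in Set.Ioc (0 : ℝ) 1, lam' * (((s - t) ⬝ᵥ (M.gradZeta k (t + a • (s - t)) y
        - M.gradZeta k M.θs y)) / (ϱf r₀ * M.Vnorm k (s - t))) := by
    intro y
    rw [linErr_sub_linErr_eq_integral, integral_const_mul, integral_div, hlam']
    field_simp
  simp only [hconv]
  refine lintegral_exp_setIntegral_le (X := fun a y => lam' * (((s - t) ⬝ᵥ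
      (M.gradZeta k (t + a • (s - t)) y - M.gradZeta k M.θs y)) / (ϱf r₀ * M.Vnorm k (s - t))))
    (c := |lam'| * ((3 * (M.lipConst * M.Vnorm k (s - t))) / |ϱf r₀ * M.Vnorm k (s - t)|))
    (((M.measurable_dotProduct_gradZeta_sub k (s - t) t).div_const _).const_mul _)
    (fun a y => ?_) (fun a ha => ?_)
  · rw [abs_mul, abs_div]
    gcongr
    exact M.abs_dotProduct_gradZeta_sub_le k _ _ y
  · refine (hED _ (M.segment_mem_Θloc hs ht ha) lam' (habs.trans hlam) (s - t)).trans ?_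
    have := sq_le_sq.2 habs
    gcongr

theorem lintegral_exp_abs_linErr_le {k : Fin K} {r₀ g ν ϱ : ℝ} {ϱf : ℝ → ℝ}
    (h : M.CondED1 k r₀ g ν ϱf) (hr₀ : 0 < r₀) (hϱ : ϱf r₀ ≤ ϱ) {lam : ℝ} (hlam0 : 0 < lam)
    (hlam : lam ≤ g) {s t : Fin (p + 1) → ℝ} (hs : M.vSeminorm k (s - M.θs) ≤ r₀)
    (ht : M.vSeminorm k (t - M.θs) ≤ r₀) :
    ∫⁻ y, ENNReal.ofReal (Real.exp
      (lam * (|ϱ⁻¹ * M.linErr k s y - ϱ⁻¹ * M.linErr k t y| / M.vSeminorm k (s - t)))) ∂M.P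
      ≤ ENNReal.ofReal (2 * Real.exp (ν ^ 2 * lam ^ 2 / 2)) := by
  have hϱpos : 0 < ϱ := (h r₀ hr₀ le_rfl).1.trans_le hϱ
  set W : (Fin n → ℝ) → ℝ := fun y =>
    (M.linErr k s y - M.linErr k t y) / (ϱ * M.Vnorm k (s - t)) with hW
  have hWm : Measurable W :=
    (((M.measurable_linErr k).comp measurable_prodMk_left).sub
      ((M.measurable_linErr k).comp measurable_prodMk_left)).div_const _
  have hle : ∀ y, ENNReal.ofReal (Real.exp
      (lam * (|ϱ⁻¹ * M.linErr k s y - ϱ⁻¹ * M.linErr k t y| / M.vSeminorm k (s - t))))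
      ≤ ENNReal.ofReal (Real.exp (lam * W y)) + ENNReal.ofReal (Real.exp (-lam * W y)) := by
    intro y
    have h1 : |ϱ⁻¹ * M.linErr k s y - ϱ⁻¹ * M.linErr k t y| / M.vSeminorm k (s - t) = |W y| := by
      rw [hW, ← mul_sub, abs_mul, abs_div, vSeminorm_apply, abs_of_pos (inv_pos.2 hϱpos),
        abs_of_nonneg (mul_nonneg hϱpos.le (M.Vnorm_nonneg k _)), inv_mul_eq_div, div_div]
    rw [h1, ← ENNReal.ofReal_add (Real.exp_pos _).le (Real.exp_pos _).le]
    refine ENNReal.ofReal_le_ofReal ?_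
    have e1 := Real.exp_pos (lam * W y)
    have e2 := Real.exp_pos (-lam * W y)
    rcases abs_cases (W y) with ⟨h2, -⟩ | ⟨h2, -⟩
    · rw [h2]; linarith
    · rw [h2, mul_neg, ← neg_mul]; linarith
  calc _ ≤ ∫⁻ y, (ENNReal.ofReal (Real.exp (lam * W y))
            + ENNReal.ofReal (Real.exp (-lam * W y))) ∂M.P := lintegral_mono hle
    _ = ∫⁻ y, ENNReal.ofReal (Real.exp (lam * W y)) ∂M.P
          + ∫⁻ y, ENNReal.ofReal (Real.exp (-lam * W y)) ∂M.P :=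
        lintegral_add_left (by fun_prop) _
    _ ≤ ENNReal.ofReal (Real.exp (ν ^ 2 * lam ^ 2 / 2))
          + ENNReal.ofReal (Real.exp (ν ^ 2 * (-lam) ^ 2 / 2)) :=
        add_le_add
          (M.lintegral_exp_linErr_le h hr₀ hϱ (by rwa [abs_of_pos hlam0]) hs ht)
          (M.lintegral_exp_linErr_le h hr₀ hϱ (by rwa [abs_neg, abs_of_pos hlam0]) hs ht)
    _ = _ := by
        rw [← ENNReal.ofReal_add (Real.exp_pos _).le (Real.exp_pos _).le, neg_sq]
        congr 1
        ring

/-! ### The error of the quadratic approximation -/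

theorem mem_Θloc_self (k : Fin K) {r : ℝ} (hr : 0 ≤ r) : M.θs ∈ M.Θloc k r := by
  simpa [Θloc, Vnorm] using hr

/-- The error `♦_k = sup_θ (|ζ_k(θ) - ζ_k(θ*) - (θ - θ*)ᵀ ∇ζ_k(θ*)| - ϱ ‖V_k (θ - θ*)‖² / 2)₊`, the
supremum being over `Θ_k(r₀)`.  It is taken over a countable dense subset, which makes no difference
by continuity and makes `♦_k` measurable. -/
noncomputable def errSup (k : Fin K) {r₀ : ℝ} (hr₀ : 0 ≤ r₀) (ϱ : ℝ) (y : Fin n → ℝ) : ℝ :=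
  have : Nonempty (M.Θloc k r₀) := ⟨⟨M.θs, M.mem_Θloc_self k hr₀⟩⟩
  ⨆ j : ℕ, max 0 (|M.linErr k (TopologicalSpace.denseSeq (M.Θloc k r₀) j) y|
    - ϱ * M.Vnorm k ((TopologicalSpace.denseSeq (M.Θloc k r₀) j : Fin (p + 1) → ℝ) - M.θs) ^ 2 / 2)

theorem measurable_errSup (k : Fin K) {r₀ : ℝ} (hr₀ : 0 ≤ r₀) (ϱ : ℝ) :
    Measurable (M.errSup k hr₀ ϱ) := by
  unfold errSup
  refine Measurable.iSup fun j => measurable_const.max (Measurable.sub_const ?_ _)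
  have h := (M.measurable_linErr k).comp (measurable_prodMk_left (x :=
    haveI : Nonempty (M.Θloc k r₀) := ⟨⟨M.θs, M.mem_Θloc_self k hr₀⟩⟩
    (TopologicalSpace.denseSeq (M.Θloc k r₀) j : Fin (p + 1) → ℝ)))
  exact h.norm

theorem errSup_nonneg (k : Fin K) {r₀ : ℝ} (hr₀ : 0 ≤ r₀) (ϱ : ℝ) (y : Fin n → ℝ) :
    0 ≤ M.errSup k hr₀ ϱ y := Real.iSup_nonneg fun _ => le_max_left _ _

theorem errSup_le (k : Fin K) {r₀ : ℝ} (hr₀ : 0 ≤ r₀) {ϱ : ℝ} {y : Fin n → ℝ} {c : ℝ} (hc : 0 ≤ c)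
    (h : ∀ θ ∈ M.Θloc k r₀, |M.linErr k θ y| - ϱ * M.Vnorm k (θ - M.θs) ^ 2 / 2 ≤ c) :
    M.errSup k hr₀ ϱ y ≤ c :=
  ciSup_le fun _ => max_le hc (h _ (Subtype.coe_prop _))

theorem continuous_linErr (k : Fin K) (y : Fin n → ℝ) : Continuous fun θ => M.linErr k θ y := by
  refine continuous_iff_continuousAt.2 fun t => ?_
  rw [ContinuousAt, tendsto_iff_dist_tendsto_zero]
  have hV : Continuous fun s => 3 * M.lipConst * M.vSeminorm k (s - t) := by
    have := M.continuous_vSeminorm k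
    fun_prop
  refine squeeze_zero (fun _ => dist_nonneg) (fun s => ?_)
    (by simpa using hV.tendsto t)
  rw [Real.dist_eq, vSeminorm_apply]
  exact M.abs_linErr_sub_linErr_le k s t y

theorem abs_linErr_le_add_errSup (k : Fin K) {r₀ : ℝ} (hr₀ : 0 ≤ r₀) {ϱ : ℝ} (hϱ : 0 ≤ ϱ)
    (y : Fin n → ℝ) {θ : Fin (p + 1) → ℝ} (hθ : θ ∈ M.Θloc k r₀) :
    |M.linErr k θ y| ≤ ϱ * M.Vnorm k (θ - M.θs) ^ 2 / 2 + M.errSup k hr₀ ϱ y := by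
  have hne : Nonempty (M.Θloc k r₀) := ⟨⟨M.θs, M.mem_Θloc_self k hr₀⟩⟩
  have hV : Continuous fun θ => M.Vnorm k (θ - M.θs) := by
    have := M.continuous_vSeminorm k
    simp only [← vSeminorm_apply]
    fun_prop
  have hcont : Continuous fun η : M.Θloc k r₀ =>
      |M.linErr k η y| - ϱ * M.Vnorm k ((η : Fin (p + 1) → ℝ) - M.θs) ^ 2 / 2 := by
    have h1 := (M.continuous_linErr k y).comp (continuous_subtype_val (p := (· ∈ M.Θloc k r₀)))
    have h2 := hV.comp (continuous_subtype_val (p := (· ∈ M.Θloc k r₀)))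
    simp only [Function.comp_def] at h1 h2
    fun_prop
  have hbdd : BddAbove (Set.range fun j : ℕ =>
      max 0 (|M.linErr k (TopologicalSpace.denseSeq (M.Θloc k r₀) j) y|
        - ϱ * M.Vnorm k ((TopologicalSpace.denseSeq (M.Θloc k r₀) j : Fin (p + 1) → ℝ)
          - M.θs) ^ 2 / 2)) := by
    refine ⟨3 * M.lipConst * r₀, Set.forall_mem_range.2 fun j => ?_⟩
    have hL := M.lipConst_nonneg
    refine max_le (by positivity) ?_
    set η := TopologicalSpace.denseSeq (M.Θloc k r₀) j
    have h1 := M.abs_linErr_sub_linErr_le k η M.θs y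
    rw [linErr_self, sub_zero] at h1
    have h2 : M.Vnorm k ((η : Fin (p + 1) → ℝ) - M.θs) ≤ r₀ := η.2
    have h3 : 3 * M.lipConst * M.Vnorm k ((η : Fin (p + 1) → ℝ) - M.θs)
        ≤ 3 * M.lipConst * r₀ := by gcongr
    have h4 : 0 ≤ ϱ * M.Vnorm k ((η : Fin (p + 1) → ℝ) - M.θs) ^ 2 / 2 := by positivity
    linarith
  have hcl : IsClosed {η : M.Θloc k r₀ | |M.linErr k η y|
      - ϱ * M.Vnorm k ((η : Fin (p + 1) → ℝ) - M.θs) ^ 2 / 2 ≤ M.errSup k hr₀ ϱ y} :=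
    isClosed_le hcont continuous_const
  have hall : ∀ η : M.Θloc k r₀, |M.linErr k η y|
      - ϱ * M.Vnorm k ((η : Fin (p + 1) → ℝ) - M.θs) ^ 2 / 2 ≤ M.errSup k hr₀ ϱ y := fun η =>
    (TopologicalSpace.denseRange_denseSeq (M.Θloc k r₀)).induction_on η hcl fun j =>
      (le_max_right _ _).trans (le_ciSup hbdd j)
  have := hall ⟨θ, hθ⟩
  simp only at this
  linarith

theorem dotProduct_D2eps_mulVec {k : Fin K} (hV : (M.V2 k).PosDef) (δ ϱ : ℝ)
    (γ : Fin (p + 1) → ℝ) :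
    γ ⬝ᵥ (M.D2eps k δ ϱ *ᵥ γ) = (1 - δ) * (γ ⬝ᵥ (M.D2 k *ᵥ γ)) - ϱ * M.Vnorm k γ ^ 2 := by
  have h : M.Vnorm k γ ^ 2 = γ ⬝ᵥ (M.V2 k *ᵥ γ) :=
    Real.sq_sqrt (by simpa using hV.posSemidef.dotProduct_mulVec_nonneg γ)
  rw [h, D2eps, sub_mulVec, dotProduct_sub, smul_mulVec, smul_mulVec, dotProduct_smul,
    dotProduct_smul, smul_eq_mul, smul_eq_mul]

/-- The expected excess is a quadratic function of `θ - θ*` up to the factor `1 ± δ`. -/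
theorem integral_excess_bounds {k : Fin K} {r₀ δ : ℝ} {δf : ℝ → ℝ} (h : M.CondL0 k r₀ δf)
    (hr₀ : 0 < r₀) (hδ : δf r₀ ≤ δ) {θ : Fin (p + 1) → ℝ} (hθ : θ ∈ M.Θloc k r₀) :
    -((1 + δ) * ((θ - M.θs) ⬝ᵥ (M.D2 k *ᵥ (θ - M.θs))) / 2) ≤ ∫ y, M.excess k θ y ∂M.P ∧
    ∫ y, M.excess k θ y ∂M.P ≤ -((1 - δ) * ((θ - M.θs) ⬝ᵥ (M.D2 k *ᵥ (θ - M.θs))) / 2) := by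
  by_cases hne : θ = M.θs
  · simp [hne]
  have hpos : 0 < (θ - M.θs) ⬝ᵥ (M.D2 k *ᵥ (θ - M.θs)) := by
    simpa using h.1.dotProduct_mulVec_pos (sub_ne_zero.2 hne)
  have h1 := abs_le.1 (((h.2 r₀ hr₀ le_rfl).2 θ hθ hne).trans hδ)
  have h2 := (div_le_iff₀ hpos).1 (sub_le_iff_le_add.1 h1.2)
  have h3 := (le_div_iff₀ hpos).1 (le_sub_iff_add_le.1 h1.1)
  constructor <;> linarith

/-- The quadratic bracketing of the excess. -/
theorem quadProc_sub_le_excess_le {k : Fin K} {r₀ δ ϱ : ℝ} {δf : ℝ → ℝ}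
    (hV : (M.V2 k).PosDef) (h : M.CondL0 k r₀ δf) (hr₀ : 0 < r₀) (hδ : δf r₀ ≤ δ) (hϱ : 0 ≤ ϱ)
    {θ : Fin (p + 1) → ℝ} (hθ : θ ∈ M.Θloc k r₀) (y : Fin n → ℝ) :
    M.quadProc k (-δ) (-ϱ) θ y - M.errSup k hr₀.le ϱ y ≤ M.excess k θ y ∧
      M.excess k θ y ≤ M.quadProc k δ ϱ θ y + M.errSup k hr₀.le ϱ y := by
  have h1 := M.integral_excess_bounds h hr₀ hδ hθ
  have h2 := abs_le.1 (M.abs_linErr_le_add_errSup k hr₀.le hϱ y hθ)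
  simp only [linErr] at h2
  simp only [quadProc, dotProduct_D2eps_mulVec M hV]
  constructor <;> linarith [h1.1, h1.2, h2.1, h2.2]

end QRModel

/-! ### Quadratic bracketing with a uniform error -/

theorem mainTheorem5 (ν₀ g₁ : ℝ) (hν₀ : 1 ≤ ν₀) (hg₁ : 0 < g₁) :
    ∃ C₁ C₂ C cl cu : ℝ, 0 < C₁ ∧ 0 < C₂ ∧ 0 < C ∧ 0 < cl ∧ 0 < cu ∧
    -- `Cr p g₀ r` bounds the `r`-th moment in dimension `p + 1` when `g_k ≥ g₀`
    ∃ Cr : ℕ → ℝ → ℝ → ℝ,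
    ∀ (p n K : ℕ) (M : QRModel p n K) (r₀ : ℝ) (g : Fin K → ℝ) (ϱf δf : Fin K → ℝ → ℝ)
      (δ ϱ : ℝ),
      0 < r₀ →
      (∀ k, g₁ * √(M.N k) ≤ g k) →
      (∀ k, M.CondED0 k (g k) ν₀) →
      (∀ k, M.CondED1 k r₀ (g k) ν₀ (ϱf k)) →
      (∀ k, M.CondL0 k r₀ (δf k)) →
      (∀ k, δf k r₀ ≤ δ) →
      (∀ k, ϱf k r₀ ≤ ϱ) →
      (∀ k, (M.D2eps k δ ϱ).PosDef) →
      ∃ (dia : Fin K → (Fin n → ℝ) → ℝ) (yc : Fin K → ℝ),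
        (∀ k, Measurable (dia k)) ∧
        (∀ k, cl * M.N k ≤ yc k ∧ yc k ≤ cu * M.N k) ∧
        (∀ k, ∀ θ ∈ M.Θloc k r₀, ∀ y,
          M.quadProc k (-δ) (-ϱ) θ y - dia k y ≤ M.excess k θ y ∧
          M.excess k θ y ≤ M.quadProc k δ ϱ θ y + dia k y) ∧
        (∀ k, ∀ x : ℝ, 0 < x → C₁ * x + C₂ * (p + 1) ≤ yc k →
          M.P {y | C₁ * x + C₂ * (p + 1) < ϱ⁻¹ * dia k y}
            ≤ ENNReal.ofReal (C * Real.exp (-x))) ∧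
        (∀ g₀ r : ℝ, 0 < g₀ → 0 < r → ∀ k, g₀ ≤ g k →
          Integrable (fun y => |ϱ⁻¹ * dia k y| ^ r) M.P ∧
          ∫ y, |ϱ⁻¹ * dia k y| ^ r ∂M.P ≤ Cr p g₀ r) := by
  have hA := one_le_tailConst ν₀
  have hA0 : 0 < tailConst ν₀ := by linarith
  refine ⟨tailConst ν₀, tailConst ν₀, 1, g₁ ^ 2, g₁ ^ 2, hA0, hA0, one_pos, by positivity,
    by positivity, fun p g₀ r => momentConst ν₀ (p + 1) g₀ r, ?_⟩
  intro p n K M r₀ g ϱf δf δ ϱ hr₀ hg hED0 hED1 hL0 hδ hϱ _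
  have hϱpos : ∀ _ : Fin K, 0 < ϱ := fun k => (hED1 k r₀ hr₀ le_rfl).1.trans_le (hϱ k)
  -- the hypotheses of the bounds for the supremum of a penalized process
  have hUm : ∀ k, Measurable (Function.uncurry fun θ y => ϱ⁻¹ * M.linErr k θ y) := fun k =>
    (M.measurable_linErr k).const_mul _
  have hUL : ∀ k s t y, |ϱ⁻¹ * M.linErr k s y - ϱ⁻¹ * M.linErr k t y|
      ≤ ϱ⁻¹ * (3 * M.lipConst) * M.vSeminorm k (s - t) := fun k s t y => by
    rw [← mul_sub, abs_mul, abs_of_pos (inv_pos.2 (hϱpos k)), M.vSeminorm_apply, mul_assoc]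
    exact mul_le_mul_of_nonneg_left (M.abs_linErr_sub_linErr_le k s t y)
      (inv_pos.2 (hϱpos k)).le
  have hUL0 : ∀ _ : Fin K, 0 ≤ ϱ⁻¹ * (3 * M.lipConst) := fun k =>
    mul_nonneg (inv_pos.2 (hϱpos k)).le (mul_nonneg (by norm_num) M.lipConst_nonneg)
  have hsup : ∀ k y c, 0 ≤ c → (∀ θ, M.vSeminorm k (θ - M.θs) ≤ r₀ →
      |ϱ⁻¹ * M.linErr k θ y| - M.vSeminorm k (θ - M.θs) ^ 2 / 2 ≤ c) →
      ϱ⁻¹ * M.errSup k hr₀.le ϱ y ≤ c := by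
    intro k y c hc h
    have hp := hϱpos k
    rw [inv_mul_le_iff₀ hp]
    refine M.errSup_le k hr₀.le (by positivity) fun θ hθ => ?_
    have h1 := h θ (by rw [M.vSeminorm_apply]; exact hθ)
    rw [M.vSeminorm_apply, abs_mul, abs_of_pos (inv_pos.2 hp)] at h1
    have h2 := mul_le_mul_of_nonneg_left h1 hp.le
    rw [mul_sub, mul_inv_cancel_left₀ hp.ne'] at h2
    linarith
  have hfr : (Module.finrank ℝ (Fin (p + 1) → ℝ)) = p + 1 := by simp
  refine ⟨fun k => M.errSup k hr₀.le ϱ, fun k => g₁ ^ 2 * M.N k,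
    fun k => M.measurable_errSup k hr₀.le ϱ, fun k => ⟨le_rfl, le_rfl⟩,
    fun k θ hθ y => M.quadProc_sub_le_excess_le (hED0 k).1 (hL0 k) hr₀ (hδ k) (hϱpos k).le hθ y,
    fun k x hx hxN => ?_, fun g₀ r hg₀ hr k hgk => ?_⟩
  · obtain ⟨κ, hκ0, hκ⟩ := M.exists_norm_le_vSeminorm (hED0 k).1
    have hN := M.N_pos (hED0 k).1
    have hz0 : 0 ≤ x + ((p : ℝ) + 1) := by positivity
    have hxg : √(x + Module.finrank ℝ (Fin (p + 1) → ℝ)) ≤ g k := by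
      refine le_trans ?_ (hg k)
      rw [hfr]
      push_cast
      refine Real.sqrt_le_iff.2 ⟨by positivity, ?_⟩
      rw [mul_pow, Real.sq_sqrt hN.le]
      refine le_trans ?_ hxN
      nlinarith
    have := measure_tailConst_mul_lt_le (P := M.P) (D := fun y => ϱ⁻¹ * M.errSup k hr₀.le ϱ y)
      (M.continuous_vSeminorm k) hκ0 hκ hr₀
      (hUm k) (fun y => by simp) (hUL k) (hUL0 k)
      (fun lam h0 h1 s hs t ht => M.lintegral_exp_abs_linErr_le (hED1 k) hr₀ (hϱ k) h0 h1 hs ht)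
      (hsup k) hx.le hxg
    rw [hfr] at this
    push_cast at this
    rw [one_mul, ← mul_add]
    exact this
  · obtain ⟨κ, hκ0, hκ⟩ := M.exists_norm_le_vSeminorm (hED0 k).1
    have := integral_rpow_le_momentConst (P := M.P)
      (D := fun y => ϱ⁻¹ * M.errSup k hr₀.le ϱ y)
      (M.continuous_vSeminorm k) hκ0 hκ hr₀
      (hUm k) (fun y => by simp) (hUL k) (hUL0 k)
      (fun lam h0 h1 s hs t ht => M.lintegral_exp_abs_linErr_le (hED1 k) hr₀ (hϱ k) h0 h1 hs ht)
      ((M.measurable_errSup k hr₀.le ϱ).const_mul _)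
      (fun y => mul_nonneg (inv_pos.2 (hϱpos k)).le (M.errSup_nonneg k hr₀.le ϱ y))
      (hsup k) hg₀ hr hgk
    rw [hfr] at this
    exact this
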